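/- Let $K$ be a field of characteristic different from $2$ and $3$, and let $L=L_{\bar 0}\oplus L_{\bar 1}$ be a finite-dimensional nilpotent Lie superalgebra over $K$ with $\dim L_{\bar 0}=m$ and $\dim L_{\bar 1}=n$, where $n\ge 1$ and $m+n\ge 6$. Suppose that the derived subsuperalgebra $L^2=[L,L]$ has dimension $m+n-2$. Let $\mathcal M(L)$ be the Schur multiplier of $L$, that is, $\mathcal M(L)\cong (R\cap F^2)/[R,F]$ for any presentation $L\cong F/R$ with $F$ a free Lie superalgebra and $R$ a graded ideal of $F$. Then $\mathcal M(L)$ is finite-dimensional and $$\dim \mathcal M(L)\le m+2n-5,$$ where $\dim$ denotes the total dimension (even plus odd part). -/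

import Mathlib

universe u v w

/-- The sign `(-1)^{ij}` for parities `i j : ZMod 2`. -/
def superSign (K : Type u) [Field K] (i j : ZMod 2) : K := (-1) ^ (i.val * j.val)

/-- A Lie superalgebra over a field `K` (of characteristic different from `2` and `3`; in
characteristics `2` and `3` one would require more): a `ZMod 2`-graded vector space `L = L₀ ⊕ L₁`
with an even bilinear bracket which is graded skew-symmetric and satisfies the graded
Jacobi identity. -/
class LieSuperalgebra (K : Type u) (L : Type v) [Field K] [AddCommGroup L] [Module K L] where
  bracket : L →ₗ[K] L →ₗ[K] L
  part : ZMod 2 → Submodule K L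
  isCompl : IsCompl (part 0) (part 1)
  bracket_mem : ∀ {i j : ZMod 2} {x y : L}, x ∈ part i → y ∈ part j → bracket x y ∈ part (i + j)
  skew : ∀ {i j : ZMod 2} {x y : L}, x ∈ part i → y ∈ part j →
    bracket x y = -(superSign K i j • bracket y x)
  jacobi : ∀ {i j k : ZMod 2} {x y z : L}, x ∈ part i → y ∈ part j → z ∈ part k →
    bracket x (bracket y z) = bracket (bracket x y) z + superSign K i j • bracket y (bracket x z)

namespace LieSuperalgebra

section Basic

variable (K : Type u) (L : Type v) [Field K] [AddCommGroup L] [Module K L] [LieSuperalgebra K L]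

/-- The even part `L₀`. -/
def even : Submodule K L := part 0

/-- The odd part `L₁`. -/
def odd : Submodule K L := part 1

variable {K L} in
/-- `[A, B]`: the linear span of all brackets `[a, b]` with `a ∈ A` and `b ∈ B`. -/
def commutator (A B : Submodule K L) : Submodule K L := Submodule.map₂ bracket A B

/-- The derived subsuperalgebra `L² = [L, L]`. -/
def derived : Submodule K L := commutator ⊤ ⊤

/-- The lower central series `C⁰(L) = L`, `Cⁱ⁺¹(L) = [L, Cⁱ(L)]`. -/
def lowerCentral : ℕ → Submodule K L
  | 0 => ⊤
  | i + 1 => commutator ⊤ (lowerCentral i)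

/-- `L` is nilpotent if `Cⁱ(L) = 0` for some `i`. -/
def Nilpotent : Prop := ∃ i : ℕ, lowerCentral K L i = ⊥

end Basic

/-- Homomorphisms of Lie superalgebras: linear maps preserving the parity and the bracket. -/
structure Hom (K : Type u) (L : Type v) (M : Type w) [Field K] [AddCommGroup L] [Module K L]
    [LieSuperalgebra K L] [AddCommGroup M] [Module K M] [LieSuperalgebra K M] where
  toLinearMap : L →ₗ[K] M
  map_part : ∀ {i : ZMod 2} {x : L}, x ∈ (part i : Submodule K L) →
    toLinearMap x ∈ (part i : Submodule K M)
  map_bracket : ∀ x y : L, toLinearMap ((bracket : L →ₗ[K] L →ₗ[K] L) x y) =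
    (bracket : M →ₗ[K] M →ₗ[K] M) (toLinearMap x) (toLinearMap y)

end LieSuperalgebra

open LieSuperalgebra

/-! ### The free Lie superalgebra on a set `X` with a parity function `p : X → ZMod 2` -/

namespace FreeLieSuper

section Construction

variable (K : Type u) [Field K] {X : Type w} (p : X → ZMod 2)

/-- The parity of a non-associative monomial: the sum of the parities of its letters. -/
def parity : FreeMagma X → ZMod 2
  | .of x => p x
  | .mul a b => parity a + parity b

theorem parity_mul (a b : FreeMagma X) : parity p (a * b) = parity p a + parity p b := rfl

/-- A non-associative monomial as an element of the free non-associative algebra. -/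
noncomputable def mono (a : FreeMagma X) : FreeMagma X →₀ K := Finsupp.single a 1

/-- The product of the free non-associative algebra, the bilinear extension of the product of
monomials. -/
noncomputable def mul :
    (FreeMagma X →₀ K) →ₗ[K] (FreeMagma X →₀ K) →ₗ[K] (FreeMagma X →₀ K) :=
  Finsupp.linearCombination K fun a => Finsupp.linearCombination K fun b => mono K (a * b)

theorem mul_mono (a b : FreeMagma X) : mul K (mono K a) (mono K b) = mono K (a * b) := by
  simp [mul, mono]

/-- The linear span of the monomials of parity `i`. -/
noncomputable def magmaPart (i : ZMod 2) : Submodule K (FreeMagma X →₀ K) :=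
  Submodule.span K {r | ∃ a : FreeMagma X, parity p a = i ∧ r = mono K a}

/-- Graded skew-symmetry and graded Jacobi identity on monomials, closed under left and right
multiplication by monomials. -/
inductive Rel : (FreeMagma X →₀ K) → Prop
  | skew (a b : FreeMagma X) :
      Rel (mono K (a * b) + superSign K (parity p a) (parity p b) • mono K (b * a))
  | jacobi (a b c : FreeMagma X) :
      Rel (mono K (a * (b * c)) - mono K ((a * b) * c)
        - superSign K (parity p a) (parity p b) • mono K (b * (a * c)))
  | mul_left (a : FreeMagma X) (r : FreeMagma X →₀ K) : Rel r → Rel (mul K (mono K a) r)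
  | mul_right (r : FreeMagma X →₀ K) (a : FreeMagma X) : Rel r → Rel (mul K r (mono K a))

/-- The two-sided ideal generated by graded skew-symmetry and the graded Jacobi identity. -/
noncomputable def relIdeal : Submodule K (FreeMagma X →₀ K) := Submodule.span K {r | Rel K p r}

end Construction

end FreeLieSuper

/-- The free Lie superalgebra over `K` on the set `X` with parities `p`. -/
def FreeLieSuperalgebra (K : Type u) [Field K] {X : Type w} (p : X → ZMod 2) : Type (max u w) :=
  (FreeMagma X →₀ K) ⧸ FreeLieSuper.relIdeal K p

namespace FreeLieSuper

section Structure

variable (K : Type u) [Field K] {X : Type w} (p : X → ZMod 2)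

noncomputable instance : AddCommGroup (FreeLieSuperalgebra K p) :=
  inferInstanceAs (AddCommGroup ((FreeMagma X →₀ K) ⧸ relIdeal K p))

noncomputable instance : Module K (FreeLieSuperalgebra K p) :=
  inferInstanceAs (Module K ((FreeMagma X →₀ K) ⧸ relIdeal K p))

/-- The quotient map from the free non-associative algebra. -/
noncomputable def mk : (FreeMagma X →₀ K) →ₗ[K] FreeLieSuperalgebra K p := (relIdeal K p).mkQ

theorem mk_surjective : Function.Surjective (mk K p) := (relIdeal K p).mkQ_surjective

theorem mk_eq_zero {r : FreeMagma X →₀ K} : mk K p r = 0 ↔ r ∈ relIdeal K p :=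
  Submodule.Quotient.mk_eq_zero _

theorem span_mono : Submodule.span K (Set.range (mono K (X := X))) = ⊤ := by
  rw [eq_top_iff]
  rintro r -
  induction r using Finsupp.induction_linear with
  | zero => exact zero_mem _
  | add f g hf hg => exact add_mem hf hg
  | single a c =>
    have h : Finsupp.single a c = c • mono K a := by simp [mono]
    rw [h]
    exact Submodule.smul_mem _ _ (Submodule.subset_span ⟨a, rfl⟩)

theorem mul_mem_left (r s : FreeMagma X →₀ K) (hs : s ∈ relIdeal K p) :
    mul K r s ∈ relIdeal K p := by
  have hr : r ∈ Submodule.span K (Set.range (mono K (X := X))) := by rw [span_mono]; trivial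
  have h : mul K r s ∈ Submodule.map₂ (mul K)
      (Submodule.span K (Set.range (mono K (X := X)))) (relIdeal K p) :=
    Submodule.apply_mem_map₂ _ hr hs
  rw [relIdeal, Submodule.map₂_span_span] at h
  refine Submodule.span_le.2 ?_ h
  rintro _ ⟨_, ⟨a, rfl⟩, t, ht, rfl⟩
  exact Submodule.subset_span (Rel.mul_left a t ht)

theorem mul_mem_right (r s : FreeMagma X →₀ K) (hr : r ∈ relIdeal K p) :
    mul K r s ∈ relIdeal K p := by
  have hs : s ∈ Submodule.span K (Set.range (mono K (X := X))) := by rw [span_mono]; trivial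
  have h : mul K r s ∈ Submodule.map₂ (mul K) (relIdeal K p)
      (Submodule.span K (Set.range (mono K (X := X)))) :=
    Submodule.apply_mem_map₂ _ hr hs
  rw [relIdeal, Submodule.map₂_span_span] at h
  refine Submodule.span_le.2 ?_ h
  rintro _ ⟨t, ht, _, ⟨a, rfl⟩, rfl⟩
  exact Submodule.subset_span (Rel.mul_right t a ht)

/-- The bracket of the free Lie superalgebra, induced by `mul`. -/
noncomputable def freeBracket :
    FreeLieSuperalgebra K p →ₗ[K] FreeLieSuperalgebra K p →ₗ[K] FreeLieSuperalgebra K p :=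
  (relIdeal K p).liftQ
    (((relIdeal K p).liftQ ((mul K).compr₂ (mk K p)).flip (by
      intro s hs
      refine LinearMap.ext fun r => ?_
      exact (mk_eq_zero K p).2 (mul_mem_left K p r s hs))).flip) (by
    intro r hr
    refine LinearMap.ext fun t => ?_
    obtain ⟨s, rfl⟩ := mk_surjective K p t
    exact (mk_eq_zero K p).2 (mul_mem_right K p r s hr))

theorem freeBracket_mk (r s : FreeMagma X →₀ K) :
    freeBracket K p (mk K p r) (mk K p s) = mk K p (mul K r s) := rfl

/-- The part of parity `i` of the free Lie superalgebra. -/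
noncomputable def freePart (i : ZMod 2) : Submodule K (FreeLieSuperalgebra K p) :=
  (magmaPart K p i).map (mk K p)

theorem mono_mem (a : FreeMagma X) : mono K a ∈ magmaPart K p (parity p a) :=
  Submodule.subset_span ⟨a, rfl, rfl⟩

theorem mul_mem_magmaPart {i j : ZMod 2} {r s : FreeMagma X →₀ K} (hr : r ∈ magmaPart K p i)
    (hs : s ∈ magmaPart K p j) : mul K r s ∈ magmaPart K p (i + j) := by
  have h : mul K r s ∈ Submodule.map₂ (mul K) (magmaPart K p i) (magmaPart K p j) :=
    Submodule.apply_mem_map₂ _ hr hs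
  rw [magmaPart, magmaPart, Submodule.map₂_span_span] at h
  refine Submodule.span_le.2 ?_ h
  rintro _ ⟨_, ⟨a, rfl, rfl⟩, _, ⟨b, rfl, rfl⟩, rfl⟩
  simp only [mul_mono]
  exact mono_mem K p (a * b)

theorem rel_homogeneous {r : FreeMagma X →₀ K} (hr : Rel K p r) :
    ∃ i, r ∈ magmaPart K p i := by
  induction hr with
  | skew a b =>
    refine ⟨parity p a + parity p b, add_mem (mono_mem K p (a * b)) (Submodule.smul_mem _ _ ?_)⟩
    rw [add_comm]
    exact mono_mem K p (b * a)
  | jacobi a b c =>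
    refine ⟨parity p a + (parity p b + parity p c), sub_mem (sub_mem (mono_mem K p (a * (b * c))) ?_)
      (Submodule.smul_mem _ _ ?_)⟩
    · rw [← add_assoc]
      exact mono_mem K p (a * b * c)
    · rw [add_left_comm]
      exact mono_mem K p (b * (a * c))
  | mul_left a r _ ih =>
    obtain ⟨i, hi⟩ := ih
    exact ⟨_, mul_mem_magmaPart K p (mono_mem K p a) hi⟩
  | mul_right r a _ ih =>
    obtain ⟨i, hi⟩ := ih
    exact ⟨_, mul_mem_magmaPart K p hi (mono_mem K p a)⟩

/-- The projection of the free non-associative algebra onto its part of parity `i`. -/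
noncomputable def proj (i : ZMod 2) : (FreeMagma X →₀ K) →ₗ[K] (FreeMagma X →₀ K) :=
  Finsupp.linearCombination K fun a => if parity p a = i then mono K a else 0

theorem proj_of_mem {i j : ZMod 2} {r : FreeMagma X →₀ K} (hr : r ∈ magmaPart K p i) :
    proj K p j r = if i = j then r else 0 := by
  induction hr using Submodule.span_induction with
  | mem x hx =>
    obtain ⟨a, rfl, rfl⟩ := hx
    simp [proj, mono]
  | zero => simp
  | add x y _ _ hx hy => rw [map_add, hx, hy]; split_ifs <;> simp
  | smul c x _ hx => rw [map_smul, hx]; split_ifs <;> simp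

theorem proj_mem_relIdeal (j : ZMod 2) {r : FreeMagma X →₀ K} (hr : r ∈ relIdeal K p) :
    proj K p j r ∈ relIdeal K p := by
  induction hr using Submodule.span_induction with
  | mem x hx =>
    obtain ⟨i, hi⟩ := rel_homogeneous K p hx
    rw [proj_of_mem K p hi]
    split_ifs
    · exact Submodule.subset_span hx
    · exact zero_mem _
  | zero => simp
  | add x y _ _ hx hy => rw [map_add]; exact add_mem hx hy
  | smul c x _ hx => rw [map_smul]; exact Submodule.smul_mem _ _ hx

theorem freePart_isCompl : IsCompl (freePart K p 0) (freePart K p 1) := by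
  constructor
  · rw [Submodule.disjoint_def]
    rintro _ ⟨r, hr, rfl⟩ ⟨s, hs, h⟩
    have h1 : s - r ∈ relIdeal K p := by
      rw [← mk_eq_zero K p, map_sub, h, sub_self]
    have h2 := proj_mem_relIdeal K p 0 h1
    rw [map_sub, proj_of_mem K p hs, proj_of_mem K p hr] at h2
    simp only [one_ne_zero, if_false, if_true, zero_sub, neg_mem_iff] at h2
    exact (mk_eq_zero K p).2 h2
  · rw [codisjoint_iff, freePart, freePart, ← Submodule.map_sup, magmaPart, magmaPart,
      ← Submodule.span_union]
    have h : ({r | ∃ a : FreeMagma X, parity p a = 0 ∧ r = mono K a} ∪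
        {r | ∃ a : FreeMagma X, parity p a = 1 ∧ r = mono K a}) = Set.range (mono K (X := X)) := by
      ext r
      constructor
      · rintro (⟨a, -, rfl⟩ | ⟨a, -, rfl⟩) <;> exact ⟨a, rfl⟩
      · rintro ⟨a, rfl⟩
        have h01 : ∀ i : ZMod 2, i = 0 ∨ i = 1 := by decide
        rcases h01 (parity p a) with h | h
        · exact Or.inl ⟨a, h, rfl⟩
        · exact Or.inr ⟨a, h, rfl⟩
    rw [h, span_mono, Submodule.map_top, LinearMap.range_eq_top]
    exact mk_surjective K p

noncomputable instance : LieSuperalgebra K (FreeLieSuperalgebra K p) where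
  bracket := freeBracket K p
  part := freePart K p
  isCompl := freePart_isCompl K p
  bracket_mem := by
    rintro i j _ _ ⟨r, hr, rfl⟩ ⟨s, hs, rfl⟩
    exact ⟨_, mul_mem_magmaPart K p hr hs, rfl⟩
  skew := by
    rintro i j _ _ ⟨r, hr, rfl⟩ ⟨s, hs, rfl⟩
    rw [eq_neg_iff_add_eq_zero, freeBracket_mk, freeBracket_mk, ← map_smul, ← map_add, mk_eq_zero]
    induction hr using Submodule.span_induction generalizing s with
    | mem x hx =>
      obtain ⟨a, rfl, rfl⟩ := hx
      induction hs using Submodule.span_induction with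
      | mem y hy =>
        obtain ⟨b, rfl, rfl⟩ := hy
        rw [mul_mono, mul_mono]
        exact Submodule.subset_span (Rel.skew a b)
      | zero => simp
      | add y z _ _ hy hz =>
        convert add_mem hy hz using 1
        simp only [map_add, LinearMap.add_apply, smul_add]
        abel
      | smul c y _ hy =>
        convert Submodule.smul_mem _ c hy using 1
        simp only [map_smul, LinearMap.smul_apply, smul_add, smul_comm c]
    | zero => simp
    | add y z _ _ hy hz =>
      convert add_mem (hy s hs) (hz s hs) using 1
      simp only [map_add, LinearMap.add_apply, smul_add]
      abel
    | smul c y _ hy =>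
      convert Submodule.smul_mem _ c (hy s hs) using 1
      simp only [map_smul, LinearMap.smul_apply, smul_add, smul_comm c]
  jacobi := by
    rintro i j k _ _ _ ⟨r, hr, rfl⟩ ⟨s, hs, rfl⟩ ⟨t, ht, rfl⟩
    rw [← sub_eq_zero, ← sub_sub]
    simp only [freeBracket_mk]
    rw [← map_smul, ← map_sub, ← map_sub, mk_eq_zero]
    induction hr using Submodule.span_induction generalizing s t with
    | mem x hx =>
      obtain ⟨a, rfl, rfl⟩ := hx
      induction hs using Submodule.span_induction generalizing t with
      | mem y hy =>
        obtain ⟨b, rfl, rfl⟩ := hy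
        induction ht using Submodule.span_induction with
        | mem z hz =>
          obtain ⟨c, rfl, rfl⟩ := hz
          simp only [mul_mono]
          exact Submodule.subset_span (Rel.jacobi a b c)
        | zero => simp
        | add y z _ _ hy hz =>
          convert add_mem hy hz using 1
          simp only [map_add, smul_add]
          abel
        | smul c y _ hy =>
          convert Submodule.smul_mem _ c hy using 1
          simp only [map_smul, smul_sub, smul_comm c]
      | zero => simp
      | add y z _ _ hy hz =>
        convert add_mem (hy t ht) (hz t ht) using 1
        simp only [map_add, LinearMap.add_apply, smul_add]
        abel
      | smul c y _ hy =>
        convert Submodule.smul_mem _ c (hy t ht) using 1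
        simp only [map_smul, LinearMap.smul_apply, smul_sub, smul_comm c]
    | zero => simp
    | add y z _ _ hy hz =>
      convert add_mem (hy s hs t ht) (hz s hs t ht) using 1
      simp only [map_add, LinearMap.add_apply, smul_add]
      abel
    | smul c y _ hy =>
      convert Submodule.smul_mem _ c (hy s hs t ht) using 1
      simp only [map_smul, LinearMap.smul_apply, smul_sub, smul_comm c]

end Structure

section Lift

variable {K : Type u} [Field K] {X : Type w} {p : X → ZMod 2}
variable {L : Type v} [AddCommGroup L] [Module K L] [LieSuperalgebra K L]

/-- The value in `L` of a non-associative monomial. -/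
def evalMono (K : Type u) [Field K] [Module K L] [LieSuperalgebra K L] (f : X → L) :
    FreeMagma X → L
  | .of x => f x
  | .mul a b => (bracket : L →ₗ[K] L →ₗ[K] L) (evalMono K f a) (evalMono K f b)

theorem evalMono_mem {f : X → L} (hf : ∀ x, f x ∈ (part (p x) : Submodule K L))
    (a : FreeMagma X) : evalMono K f a ∈ (part (parity p a) : Submodule K L) := by
  induction a with
  | ih1 x => exact hf x
  | ih2 a b ha hb => exact bracket_mem ha hb

/-- The linear extension of `evalMono`. -/
noncomputable def evalLin (K : Type u) [Field K] [Module K L] [LieSuperalgebra K L] (f : X → L) :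
    (FreeMagma X →₀ K) →ₗ[K] L :=
  Finsupp.linearCombination K (evalMono K f)

theorem evalLin_mono (f : X → L) (a : FreeMagma X) :
    evalLin K f (mono K a) = evalMono K f a := by
  simp [evalLin, mono]

theorem evalLin_mul (f : X → L) (r s : FreeMagma X →₀ K) :
    evalLin K f (mul K r s) = (bracket : L →ₗ[K] L →ₗ[K] L) (evalLin K f r) (evalLin K f s) := by
  have h : (mul K).compr₂ (evalLin K f) =
      (bracket : L →ₗ[K] L →ₗ[K] L).compl₁₂ (evalLin K f) (evalLin K f) := by
    ext a b
    change evalLin K f (mul K (mono K a) (mono K b)) =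
      bracket (evalLin K f (mono K a)) (evalLin K f (mono K b))
    rw [mul_mono, evalLin_mono, evalLin_mono, evalLin_mono]
    rfl
  exact LinearMap.congr_fun₂ h r s

theorem evalLin_rel {f : X → L} (hf : ∀ x, f x ∈ (part (p x) : Submodule K L))
    {r : FreeMagma X →₀ K} (hr : Rel K p r) : evalLin K f r = 0 := by
  induction hr with
  | skew a b =>
    rw [map_add, map_smul, evalLin_mono, evalLin_mono, ← eq_neg_iff_add_eq_zero]
    exact LieSuperalgebra.skew (evalMono_mem hf a) (evalMono_mem hf b)
  | jacobi a b c =>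
    rw [map_sub, map_sub, map_smul, evalLin_mono, evalLin_mono, evalLin_mono, sub_sub, sub_eq_zero]
    exact LieSuperalgebra.jacobi (evalMono_mem hf a) (evalMono_mem hf b) (evalMono_mem hf c)
  | mul_left a r _ ih => rw [evalLin_mul, ih, map_zero]
  | mul_right r a _ ih => rw [evalLin_mul, ih, map_zero, LinearMap.zero_apply]

/-- The homomorphism from the free Lie superalgebra extending a parity preserving map. -/
noncomputable def lift (f : X → L) (hf : ∀ x, f x ∈ (part (p x) : Submodule K L)) :
    LieSuperalgebra.Hom K (FreeLieSuperalgebra K p) L where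
  toLinearMap := (relIdeal K p).liftQ (evalLin K f)
    (Submodule.span_le.2 fun _ hr => evalLin_rel hf hr)
  map_part := by
    rintro i _ ⟨r, hr, rfl⟩
    change evalLin K f r ∈ part i
    induction hr using Submodule.span_induction with
    | mem x hx =>
      obtain ⟨a, rfl, rfl⟩ := hx
      rw [evalLin_mono]
      exact evalMono_mem hf a
    | zero => rw [map_zero]; exact zero_mem _
    | add x y _ _ hx hy => rw [map_add]; exact add_mem hx hy
    | smul c x _ hx => rw [map_smul]; exact Submodule.smul_mem _ _ hx
  map_bracket := by
    intro x y
    obtain ⟨r, rfl⟩ := mk_surjective K p x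
    obtain ⟨s, rfl⟩ := mk_surjective K p y
    exact evalLin_mul f r s

theorem lift_of (f : X → L) (hf : ∀ x, f x ∈ (part (p x) : Submodule K L)) (x : X) :
    (lift f hf).toLinearMap (mk K p (mono K (FreeMagma.of x))) = f x :=
  evalLin_mono f (FreeMagma.of x)

end Lift

end FreeLieSuper

namespace LieSuperalgebra

/-- A free presentation `0 → R → F → L → 0` of the Lie superalgebra `L`: a surjective homomorphism
from the free Lie superalgebra `F` on a set `X` of generators with parities `p`. -/
structure FreePresentation (K : Type u) (L : Type v) [Field K] [AddCommGroup L] [Module K L]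
    [LieSuperalgebra K L] where
  X : Type w
  p : X → ZMod 2
  hom : Hom K (FreeLieSuperalgebra K p) L
  surjective : Function.Surjective hom.toLinearMap

section Multiplier

variable {K : Type u} {L : Type v} [Field K] [AddCommGroup L] [Module K L] [LieSuperalgebra K L]

/-- The ideal `R = ker (F → L)` of a free presentation. -/
noncomputable def FreePresentation.R (P : FreePresentation.{u, v, w} K L) :
    Submodule K (FreeLieSuperalgebra K P.p) := LinearMap.ker P.hom.toLinearMap

/-- The Schur multiplier `(R ∩ F²) / [R, F]` computed from a free presentation. -/
abbrev FreePresentation.Multiplier (P : FreePresentation.{u, v, w} K L) : Type (max u w) :=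
  ↥(P.R ⊓ derived K (FreeLieSuperalgebra K P.p)) ⧸
    (commutator P.R ⊤).submoduleOf (P.R ⊓ derived K (FreeLieSuperalgebra K P.p))

/-- `[R, F] ⊆ R ∩ F²`, so that the quotient above is by the whole of `[R, F]`. -/
theorem FreePresentation.commutator_le (P : FreePresentation.{u, v, w} K L) :
    commutator P.R ⊤ ≤ P.R ⊓ derived K (FreeLieSuperalgebra K P.p) := by
  refine Submodule.map₂_le.2 fun r hr s _ => ⟨?_, Submodule.apply_mem_map₂ _ trivial trivial⟩
  rw [FreePresentation.R, LinearMap.mem_ker] at hr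
  change P.hom.toLinearMap _ = 0
  rw [P.hom.map_bracket, hr, map_zero, LinearMap.zero_apply]

variable (K L) in
/-- The canonical free presentation, on all homogeneous elements of `L`. -/
noncomputable def canonicalPresentation : FreePresentation.{u, v, v} K L where
  X := (even K L) ⊕ (odd K L)
  p := Sum.elim (fun _ => 0) (fun _ => 1)
  hom := FreeLieSuper.lift (Sum.elim (fun x => x.1) (fun x => x.1)) (by
    rintro (x | x)
    · exact x.2
    · exact x.2)
  surjective := by
    rw [← LinearMap.range_eq_top, eq_top_iff,
      ← codisjoint_iff.1 (isCompl (K := K) (L := L)).codisjoint]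
    refine sup_le (fun x hx => ?_) (fun x hx => ?_)
    · let y : (even K L) ⊕ (odd K L) := Sum.inl ⟨x, hx⟩
      exact ⟨_, FreeLieSuper.lift_of _ _ y⟩
    · let y : (even K L) ⊕ (odd K L) := Sum.inr ⟨x, hx⟩
      exact ⟨_, FreeLieSuper.lift_of _ _ y⟩

end Multiplier

end LieSuperalgebra

/-! Put E = F/[R, F]. This is a central extension of L, and (R ∩ F²)/[R, F] lies in the kernel of E²
→ L². Hence dim M(L) ≤ dim E² - (m+n-2), and it suffices to show dim E² ≤ 2m+3n-7; this is
`finrank_derived_extension_le`.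

Write C₀ = L, C₁ = L², C₂ = [L, L²], and so on, and similarly for E. Since L² has codimension 2, L
is generated by two homogeneous elements x, y, and E is generated by lifts of them modulo the
central kernel. They cannot both be even, because then L would be even (`even_eq_top`), against n ≥
1.

By nilpotency C₃(E) = [x, C₂(E)] + [y, C₂(E)], and ad x, ad y kill the central kernel, so they
factor through L. Hence dim C₃(E) ≤ 2 dim C₂(L) (`finrank_lowerCentral_succ_le`). The quotient
C₁(E)/C₃(E) is spanned by a few brackets of length 2 and 3 in x and y, while brackets of length 2
that are independent modulo C₂(L) make C₂(L) smaller. With d = m+n-2 = dim L², balancing the two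
usually gives dim E² ≤ 2d, which suffices once n ≥ 3.

The remaining work is with small n and with degenerate relations in length 2. For x even and y odd,
n = 2 is handled by listing at most seven spanning brackets of E² (`evenOdd_finrank_le_seven`), and
the case n = 3 with [y, y] ∈ C₂ is impossible (`evenOdd_lowerCentral_four`). For x, y both odd, a
relation among [x, x], [x, y], [y, y] modulo C₂ must have zero discriminant, or else C₂ = 0
(`oddOdd_lowerCentral_two`); such a relation also makes C₂(E)/C₃(E) at most one-dimensional. -/

namespace LieSuperalgebra

/-! ### Consequences of the graded axioms for even and odd elements. -/

section Identities

variable {K : Type u} {E : Type v} [Field K] [AddCommGroup E] [Module K E] [LieSuperalgebra K E]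

local notation "β" => bracket (K := K) (L := E)
local notation "𝓔" => part (K := K) (L := E)

theorem exists_add_eq (z : E) : ∃ z₀ ∈ 𝓔 0, ∃ z₁ ∈ 𝓔 1, z₀ + z₁ = z := by
  have h : z ∈ 𝓔 0 ⊔ 𝓔 1 := by
    rw [codisjoint_iff.1 (isCompl (K := K) (L := E)).codisjoint]; trivial
  exact Submodule.mem_sup.1 h

theorem eq_zero_of_mem_of_mem {z : E} (h₀ : z ∈ 𝓔 0) (h₁ : z ∈ 𝓔 1) : z = 0 :=
  Submodule.disjoint_def.1 (isCompl (K := K) (L := E)).disjoint z h₀ h₁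

theorem part_induction {P : E → Prop} (hadd : ∀ x y, P x → P y → P (x + y))
    (hpart : ∀ i : ZMod 2, ∀ x ∈ 𝓔 i, P x) (z : E) : P z := by
  obtain ⟨z₀, h₀, z₁, h₁, rfl⟩ := exists_add_eq (K := K) z
  exact hadd _ _ (hpart 0 _ h₀) (hpart 1 _ h₁)

theorem bracket_mem_of_add_eq {i j k : ZMod 2} {x y : E} (hx : x ∈ 𝓔 i) (hy : y ∈ 𝓔 j)
    (h : i + j = k) : β x y ∈ 𝓔 k := h ▸ bracket_mem hx hy

theorem skew_even {x : E} (hx : x ∈ 𝓔 0) (y : E) : β x y = -β y x := by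
  obtain ⟨y₀, h₀, y₁, h₁, rfl⟩ := exists_add_eq (K := K) y
  rw [map_add, map_add, LinearMap.add_apply, skew hx h₀, skew hx h₁]
  simp only [superSign, ZMod.val_zero, zero_mul, pow_zero, one_smul]
  abel

theorem skew_odd {x y : E} (hx : x ∈ 𝓔 1) (hy : y ∈ 𝓔 1) : β x y = β y x := by
  rw [skew hx hy]
  have h : (1 : ZMod 2).val = 1 := rfl
  simp [superSign, h]

theorem bracket_self_even (h2 : (2 : K) ≠ 0) {x : E} (hx : x ∈ 𝓔 0) : β x x = 0 := by
  have h : (2 : K) • β x x = 0 := by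
    rw [two_smul]; nth_rewrite 1 [skew_even hx]; simp
  exact (smul_eq_zero.1 h).resolve_left h2

theorem jacobi_any {i j : ZMod 2} {x y : E} (hx : x ∈ 𝓔 i) (hy : y ∈ 𝓔 j) (z : E) :
    β x (β y z) = β (β x y) z + superSign K i j • β y (β x z) := by
  obtain ⟨z₀, h₀, z₁, h₁, rfl⟩ := exists_add_eq (K := K) z
  simp only [map_add, smul_add]
  rw [jacobi hx hy h₀, jacobi hx hy h₁]
  abel

theorem jacobi_even {x : E} (hx : x ∈ 𝓔 0) (y z : E) :
    β x (β y z) = β (β x y) z + β y (β x z) := by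
  obtain ⟨y₀, h₀, y₁, h₁, rfl⟩ := exists_add_eq (K := K) y
  simp only [map_add, LinearMap.add_apply]
  rw [jacobi_any hx h₀, jacobi_any hx h₁]
  simp only [superSign, ZMod.val_zero, zero_mul, pow_zero, one_smul]
  abel

theorem jacobi_odd {x y : E} (hx : x ∈ 𝓔 1) (hy : y ∈ 𝓔 1) (z : E) :
    β x (β y z) = β (β x y) z - β y (β x z) := by
  rw [jacobi_any hx hy]
  have h : (1 : ZMod 2).val = 1 := rfl
  simp [superSign, h, sub_eq_add_neg]

theorem bracket_bracket_self_odd {y : E} (hy : y ∈ 𝓔 1) (z : E) :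
    β (β y y) z = (2 : K) • β y (β y z) := by
  have h := jacobi_odd hy hy z
  rw [two_smul, ← sub_eq_iff_eq_add.1 h.symm]

/-- Jacobi gives [[y, y], y] = 2[y, [y, y]], while [y, y] is even, so the left side is also -[y, [y,
y]]. -/
theorem bracket_cube_odd (h3 : (3 : K) ≠ 0) {y : E} (hy : y ∈ 𝓔 1) : β y (β y y) = 0 := by
  have h := bracket_bracket_self_odd hy y
  rw [skew_even (bracket_mem_of_add_eq hy hy rfl)] at h
  have h' : (3 : K) • β y (β y y) = 0 := by
    linear_combination (norm := module) (-1 : K) • h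
  exact (smul_eq_zero.1 h').resolve_left h3

end Identities

/-! ### The lower central series and generation by two elements modulo a central subspace. -/

section LowerCentral

variable {K : Type u} {E : Type v} [Field K] [AddCommGroup E] [Module K E] [LieSuperalgebra K E]

local notation "β" => bracket (K := K) (L := E)
local notation "𝓔" => part (K := K) (L := E)
local notation "𝓒" => lowerCentral K E

theorem bracket_mem_lowerCentral (x : E) {k : ℕ} {z : E} (hz : z ∈ 𝓒 k) : β x z ∈ 𝓒 (k + 1) :=
  Submodule.apply_mem_map₂ _ trivial hz

theorem bracket_mem_lowerCentral_one (x z : E) : β x z ∈ 𝓒 1 :=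
  bracket_mem_lowerCentral x (k := 0) Submodule.mem_top

theorem lowerCentral_succ_le (k : ℕ) : 𝓒 (k + 1) ≤ 𝓒 k := by
  induction k with
  | zero => exact le_top
  | succ k ih => exact Submodule.map₂_le_map₂_right ih

theorem lowerCentral_antitone : Antitone 𝓒 := antitone_nat_of_succ_le lowerCentral_succ_le

/-- For homogeneous p, q the Jacobi identity turns [[p, q], z] into [p, [q, z]] and [q, [p, z]],
which go down two steps. -/
theorem bracket_derived_mem {k : ℕ} {u z : E} (hu : u ∈ 𝓒 1) (hz : z ∈ 𝓒 k) :
    β u z ∈ 𝓒 (k + 2) := by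
  have h : 𝓒 1 ≤ (𝓒 (k + 2)).comap (LinearMap.flip β z) := by
    refine (Submodule.map₂_le (f := β) (p := ⊤) (q := 𝓒 0)).2 fun p _ q _ => ?_
    change β (β p q) z ∈ 𝓒 (k + 2)
    revert q
    refine part_induction (K := K) (P := fun p => ∀ q ∈ 𝓒 0, β (β p q) z ∈ 𝓒 (k + 2)) ?_ ?_ p
    · intro p p' h h' q hq
      rw [map_add, LinearMap.add_apply, map_add, LinearMap.add_apply]
      exact add_mem (h q hq) (h' q hq)
    intro i p hp q _
    refine part_induction (K := K) (P := fun q => β (β p q) z ∈ 𝓒 (k + 2)) ?_ ?_ q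
    · intro q q' h h'
      rw [map_add, map_add, LinearMap.add_apply]
      exact add_mem h h'
    intro j q hq
    rw [eq_sub_of_add_eq (jacobi_any hp hq z).symm]
    exact sub_mem (bracket_mem_lowerCentral _ (bracket_mem_lowerCentral _ hz))
      (Submodule.smul_mem _ _ (bracket_mem_lowerCentral _ (bracket_mem_lowerCentral _ hz)))
  exact h hu

theorem Nilpotent.eq_bot_of_le (hnil : Nilpotent K E) {k : ℕ} (h : 𝓒 k ≤ 𝓒 (k + 1)) :
    𝓒 k = ⊥ := by
  obtain ⟨N, hN⟩ := hnil
  have key : ∀ j, 𝓒 (k + j) ≤ 𝓒 (k + j + 1) := by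
    intro j
    induction j with
    | zero => exact h
    | succ j ih => exact Submodule.map₂_le_map₂_right ih
  have key' : ∀ j, 𝓒 k ≤ 𝓒 (k + j) := by
    intro j
    induction j with
    | zero => exact le_rfl
    | succ j ih => exact ih.trans (key j)
  rw [eq_bot_iff, ← hN]
  exact (key' N).trans (lowerCentral_antitone (Nat.le_add_left N k))

/-- `E` is nilpotent and generated by `x` and `y` modulo the central subspace `A`. -/
structure TwoGenerated (A : Submodule K E) (x y : E) : Prop where
  left : ∀ a ∈ A, ∀ z, β a z = 0
  right : ∀ a ∈ A, ∀ z, β z a = 0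
  gen : ⊤ ≤ Submodule.span K {x, y} ⊔ A ⊔ 𝓒 1
  nil : Nilpotent K E

namespace TwoGenerated

variable {A : Submodule K E} {x y : E}

theorem symm (h : TwoGenerated A x y) : TwoGenerated A y x where
  left := h.left
  right := h.right
  gen := by rw [Set.pair_comm]; exact h.gen
  nil := h.nil

/-- In [E, Cₖ] the left factor splits along span{x, y} + A + C₁: the part in A contributes nothing
and the part in C₁ lands in Cₖ₊₂. Keeping `T` arbitrary lets successive layers be chained. -/
theorem lowerCentral_succ_le_of_le (h : TwoGenerated A x y) {k : ℕ} {T : Submodule K E}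
    (hx : ∀ z ∈ 𝓒 k, β x z ∈ T) (hy : ∀ z ∈ 𝓒 k, β y z ∈ T) (hT : 𝓒 (k + 2) ≤ T) :
    𝓒 (k + 1) ≤ T := by
  refine Submodule.map₂_le.2 fun p _ z hz => ?_
  have key : Submodule.span K {x, y} ⊔ A ⊔ 𝓒 1 ≤ T.comap (LinearMap.flip β z) := by
    refine sup_le (sup_le (Submodule.span_le.2 ?_) ?_) ?_
    · rintro _ (rfl | rfl)
      · exact hx z hz
      · exact hy z hz
    · intro a ha
      change β a z ∈ T
      rw [h.left a ha]; exact zero_mem _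
    · intro u hu
      exact hT (bracket_derived_mem hu hz)
  exact key (h.gen trivial)

/-- If `S` spans layer k up to central elements, then [x, S] and [y, S] span layer k+1. -/
theorem step (h : TwoGenerated A x y) {k : ℕ} {S : Set E} {T : Submodule K E}
    (hS : 𝓒 k ≤ Submodule.span K S ⊔ A ⊔ 𝓒 (k + 1)) (hx : ∀ s ∈ S, β x s ∈ T)
    (hy : ∀ s ∈ S, β y s ∈ T) (hT : 𝓒 (k + 2) ≤ T) : 𝓒 (k + 1) ≤ T := by
  have key : ∀ w : E, (∀ s ∈ S, β w s ∈ T) → ∀ z ∈ 𝓒 k, β w z ∈ T := by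
    intro w hw z hz
    have : Submodule.span K S ⊔ A ⊔ 𝓒 (k + 1) ≤ T.comap (β w) := by
      refine sup_le (sup_le (Submodule.span_le.2 hw) ?_) ?_
      · intro a ha
        change β w a ∈ T
        rw [h.right a ha]; exact zero_mem _
      · intro u hu
        exact hT (bracket_mem_lowerCentral w hu)
    exact this (hS hz)
  exact h.lowerCentral_succ_le_of_le (key x hx) (key y hy) hT

theorem lowerCentral_succ_le_map (h : TwoGenerated A x y) (k : ℕ) :
    𝓒 (k + 1) ≤ (𝓒 k).map (β x) ⊔ (𝓒 k).map (β y) := by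
  obtain ⟨N, hN⟩ := h.nil
  -- Descending induction on k: the error term Cₖ₊₂ is absorbed by the statement for k+1, starting
  -- where the series is zero.
  have key : ∀ j k, N ≤ k + j → 𝓒 (k + 1) ≤ (𝓒 k).map (β x) ⊔ (𝓒 k).map (β y) := by
    intro j
    induction j with
    | zero =>
      intro k hk
      exact ((lowerCentral_antitone (by omega : N ≤ k + 1)).trans hN.le).trans bot_le
    | succ j ih =>
      intro k hk
      refine h.lowerCentral_succ_le_of_le
        (fun z hz => Submodule.mem_sup_left (Submodule.mem_map_of_mem hz))
        (fun z hz => Submodule.mem_sup_right (Submodule.mem_map_of_mem hz)) ?_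
      refine (ih (k + 1) (by omega)).trans ?_
      exact sup_le_sup (Submodule.map_mono (lowerCentral_succ_le k))
        (Submodule.map_mono (lowerCentral_succ_le k))
  exact key N k (by omega)

end TwoGenerated

end LowerCentral

/-! ### Dimension counts for subspaces. -/

section LinearAlgebra

variable {K : Type u} {E : Type v} [Field K] [AddCommGroup E] [Module K E]

theorem finite_and_finrank_le_of_le_span_sup {k : ℕ} (s : Fin k → E) {V W : Submodule K E}
    [Module.Finite K W] (h : V ≤ Submodule.span K (Set.range s) ⊔ W) :
    Module.Finite K V ∧ Module.finrank K V ≤ k + Module.finrank K W := by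
  have : Module.Finite K (Submodule.span K (Set.range s)) :=
    Module.Finite.span_of_finite K (Set.finite_range s)
  refine ⟨Submodule.finiteDimensional_of_le h, (Submodule.finrank_mono h).trans ?_⟩
  refine (Submodule.finrank_add_le_finrank_add_finrank _ _).trans ?_
  exact Nat.add_le_add_right ((finrank_range_le_card s).trans (by simp)) _

theorem finrank_add_one_le [Module.Finite K E] {V W : Submodule K E} (h : W ≤ V) {b : E}
    (hb : b ∈ V) (hbW : b ∉ W) : Module.finrank K W + 1 ≤ Module.finrank K V :=
  Submodule.finrank_lt_finrank_of_lt (lt_of_le_of_ne h fun e => hbW (e ▸ hb))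

theorem finrank_add_two_le [Module.Finite K E] {V W : Submodule K E} (h : W ≤ V) {b c : E}
    (hb : b ∈ V) (hc : c ∈ V) (hbc : ∀ r s : K, r • b + s • c ∈ W → r = 0 ∧ s = 0) :
    Module.finrank K W + 2 ≤ Module.finrank K V := by
  have hbW : b ∉ W := fun hb => one_ne_zero (hbc 1 0 (by simpa using hb)).1
  have h1 := finrank_add_one_le (le_sup_left : W ≤ W ⊔ Submodule.span K {b})
    (Submodule.mem_sup_right (Submodule.mem_span_singleton_self b)) hbW
  have h2 : c ∉ W ⊔ Submodule.span K {b} := by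
    intro hc
    obtain ⟨w, hw, _, hz, rfl⟩ := Submodule.mem_sup.1 hc
    obtain ⟨r, rfl⟩ := Submodule.mem_span_singleton.1 hz
    refine one_ne_zero (hbc (-r) 1 ?_).2
    convert hw using 1
    module
  have h3 := finrank_add_one_le (sup_le h ((Submodule.span_singleton_le_iff_mem _ _).2 hb)) hc h2
  omega

theorem finrank_add_three_le [Module.Finite K E] {V W : Submodule K E} (h : W ≤ V) {b c d : E}
    (hb : b ∈ V) (hc : c ∈ V) (hd : d ∈ V)
    (hbc : ∀ r s t : K, r • b + s • c + t • d ∈ W → r = 0 ∧ s = 0 ∧ t = 0) :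
    Module.finrank K W + 3 ≤ Module.finrank K V := by
  have hbW : b ∉ W := fun hb => one_ne_zero (hbc 1 0 0 (by simpa using hb)).1
  have h1 := finrank_add_one_le (le_sup_left : W ≤ W ⊔ Submodule.span K {b})
    (Submodule.mem_sup_right (Submodule.mem_span_singleton_self b)) hbW
  have h2 := finrank_add_two_le (sup_le h ((Submodule.span_singleton_le_iff_mem _ _).2 hb)) hc hd (by
    intro s t hst
    obtain ⟨w, hw, _, hz, e⟩ := Submodule.mem_sup.1 hst
    obtain ⟨r, rfl⟩ := Submodule.mem_span_singleton.1 hz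
    refine (hbc (-r) s t ?_).2
    convert hw using 1
    rw [add_assoc, ← e]
    module)
  omega

/-- The image of `Q` under a map that factors through a surjection `π` is not larger than the image
under `π`. -/
theorem finite_and_finrank_map_le {L : Type w} [AddCommGroup L] [Module K L] [Module.Finite K L]
    (π : E →ₗ[K] L) (hπ : Function.Surjective π) (f : E →ₗ[K] E)
    (hf : ∀ a ∈ LinearMap.ker π, f a = 0) (Q : Submodule K E) :
    Module.Finite K (Q.map f) ∧ Module.finrank K (Q.map f) ≤ Module.finrank K (Q.map π) := by
  obtain ⟨s, hs⟩ := π.exists_rightInverse_of_surjective (LinearMap.range_eq_top.2 hπ)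
  have h : f = (f ∘ₗ s) ∘ₗ π := by
    ext z
    have h1 : f (z - s (π z)) = 0 := by
      apply hf
      have h2 := LinearMap.congr_fun hs (π z)
      simp only [LinearMap.comp_apply, LinearMap.id_apply] at h2
      rw [LinearMap.mem_ker, map_sub, h2, sub_self]
    rw [map_sub, sub_eq_zero] at h1
    exact h1
  rw [h, Submodule.map_comp]
  exact ⟨inferInstance, Submodule.finrank_map_le _ _⟩

end LinearAlgebra

end LieSuperalgebra

namespace LieSuperalgebra

/-! ### Graded subspaces. -/

section Graded

variable {K : Type u} {E : Type v} [Field K] [AddCommGroup E] [Module K E] [LieSuperalgebra K E]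

local notation "β" => bracket (K := K) (L := E)
local notation "𝓔" => part (K := K) (L := E)
local notation "𝓒" => lowerCentral K E

/-- A subspace is graded if it is the sum of its intersections with the even and the odd part. -/
def IsGraded (V : Submodule K E) : Prop := V ≤ (V ⊓ 𝓔 0) ⊔ (V ⊓ 𝓔 1)

theorem IsGraded.exists_add_eq {V : Submodule K E} (hV : IsGraded V) {z : E} (hz : z ∈ V) :
    ∃ z₀ ∈ V, ∃ z₁ ∈ V, z₀ ∈ 𝓔 0 ∧ z₁ ∈ 𝓔 1 ∧ z₀ + z₁ = z := by
  obtain ⟨z₀, h₀, z₁, h₁, e⟩ := Submodule.mem_sup.1 (hV hz)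
  exact ⟨z₀, h₀.1, z₁, h₁.1, h₀.2, h₁.2, e⟩

theorem eq_and_eq_of_add_eq_add {a b c d : E} (ha : a ∈ 𝓔 0) (hb : b ∈ 𝓔 1) (hc : c ∈ 𝓔 0)
    (hd : d ∈ 𝓔 1) (h : a + b = c + d) : a = c ∧ b = d := by
  have h' : a - c = d - b := by rw [sub_eq_sub_iff_add_eq_add, h, add_comm]
  have h0 : a - c = 0 := eq_zero_of_mem_of_mem (sub_mem ha hc) (h' ▸ sub_mem hd hb)
  exact ⟨sub_eq_zero.1 h0, (sub_eq_zero.1 (h' ▸ h0)).symm⟩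

theorem IsGraded.mem_and_mem {V : Submodule K E} (hV : IsGraded V) {a b : E} (ha : a ∈ 𝓔 0)
    (hb : b ∈ 𝓔 1) (h : a + b ∈ V) : a ∈ V ∧ b ∈ V := by
  obtain ⟨z₀, h₀, z₁, h₁, h₀', h₁', e⟩ := hV.exists_add_eq h
  obtain ⟨rfl, rfl⟩ := eq_and_eq_of_add_eq_add ha hb h₀' h₁' e.symm
  exact ⟨h₀, h₁⟩

theorem isGraded_top : IsGraded (⊤ : Submodule K E) := by
  rw [IsGraded, top_inf_eq, top_inf_eq, codisjoint_iff.1 (isCompl (K := K) (L := E)).codisjoint]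

theorem IsGraded.commutator {V W : Submodule K E} (hV : IsGraded V) (hW : IsGraded W) :
    IsGraded (commutator V W) := by
  refine Submodule.map₂_le.2 fun p hp q hq => ?_
  obtain ⟨p₀, hp₀, p₁, hp₁, hp₀', hp₁', rfl⟩ := hV.exists_add_eq hp
  obtain ⟨q₀, hq₀, q₁, hq₁, hq₀', hq₁', rfl⟩ := hW.exists_add_eq hq
  rw [map_add, LinearMap.map_add₂, LinearMap.map_add₂]
  refine add_mem (add_mem (Submodule.mem_sup_left ⟨?_, ?_⟩) (Submodule.mem_sup_right ⟨?_, ?_⟩))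
    (add_mem (Submodule.mem_sup_right ⟨?_, ?_⟩) (Submodule.mem_sup_left ⟨?_, ?_⟩))
  all_goals first
    | exact bracket_mem_of_add_eq ‹_› ‹_› rfl
    | exact Submodule.apply_mem_map₂ _ ‹_› ‹_›

theorem isGraded_lowerCentral (k : ℕ) : IsGraded (𝓒 k) := by
  induction k with
  | zero => exact isGraded_top
  | succ k ih => exact isGraded_top.commutator ih

end Graded

namespace TwoGenerated

variable {K : Type u} {E : Type v} [Field K] [AddCommGroup E] [Module K E] [LieSuperalgebra K E]
variable {A : Submodule K E} {x y : E}

local notation "β" => bracket (K := K) (L := E)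
local notation "𝓔" => part (K := K) (L := E)
local notation "𝓒" => lowerCentral K E

theorem bracket_mem_of_mem_sup (h : TwoGenerated A x y) {k : ℕ} {z : E} (hz : z ∈ A ⊔ 𝓒 k)
    (p : E) : β p z ∈ 𝓒 (k + 1) := by
  obtain ⟨a, ha, z', hz', rfl⟩ := Submodule.mem_sup.1 hz
  rw [map_add, h.right a ha, zero_add]
  exact bracket_mem_lowerCentral p hz'

theorem lowerCentral_succ_eq_bot (h : TwoGenerated A x y) {k : ℕ} (hk : 𝓒 k ≤ A ⊔ 𝓒 (k + 1)) :
    𝓒 (k + 1) = ⊥ := by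
  refine h.nil.eq_bot_of_le (h.step (S := ∅) ?_ (by simp) (by simp) le_rfl)
  simpa using hk

/-- Every layer is spanned by brackets of even elements modulo the next one; nilpotency ends the
descent. -/
theorem even_eq_top (h : TwoGenerated (⊥ : Submodule K E) x y) (hx : x ∈ 𝓔 0) (hy : y ∈ 𝓔 0) :
    𝓔 0 = ⊤ := by
  have hxy : Submodule.span K {x, y} ≤ 𝓔 0 := by
    refine Submodule.span_le.2 ?_
    rintro _ (rfl | rfl) <;> assumption
  have key : ∀ k, 𝓒 k ≤ 𝓔 0 ⊔ 𝓒 (k + 1) := by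
    intro k
    induction k with
    | zero =>
      refine h.gen.trans ?_
      rw [sup_bot_eq]
      exact sup_le_sup_right hxy _
    | succ k ih =>
      have aux : ∀ w ∈ 𝓔 0, ∀ z ∈ 𝓒 k, β w z ∈ 𝓔 0 ⊔ 𝓒 (k + 2) := by
        intro w hw z hz
        obtain ⟨p, hp, q, hq, rfl⟩ := Submodule.mem_sup.1 (ih hz)
        rw [map_add]
        exact add_mem (Submodule.mem_sup_left (bracket_mem_of_add_eq hw hp rfl))
          (Submodule.mem_sup_right (bracket_mem_lowerCentral w hq))
      exact h.lowerCentral_succ_le_of_le (aux x hx) (aux y hy) le_sup_right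
  obtain ⟨N, hN⟩ := h.nil
  have key' : ∀ k, ⊤ ≤ 𝓔 0 ⊔ 𝓒 k := by
    intro k
    induction k with
    | zero => exact le_sup_right
    | succ k ih => exact ih.trans (sup_le le_sup_left (key k))
  have := key' N
  rwa [hN, sup_bot_eq, top_le_iff] at this

/-! ### One even generator x and one odd generator y. -/

section EvenOdd

theorem evenOdd_one (h : TwoGenerated A x y) (h2 : (2 : K) ≠ 0) (hx : x ∈ 𝓔 0)
    {T : Submodule K E} (hb : β x y ∈ T) (hc : β y y ∈ T) (hT : 𝓒 2 ≤ T) : 𝓒 1 ≤ T := by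
  refine h.step (k := 0) (S := {x, y}) h.gen ?_ ?_ hT
  · rintro _ (rfl | rfl)
    · rw [bracket_self_even h2 hx]; exact zero_mem _
    · exact hb
  · rintro _ (rfl | rfl)
    · rw [← neg_neg (β y _), ← skew_even hx]; exact neg_mem hb
    · exact hc

theorem bracket_even_sq (hx : x ∈ 𝓔 0) (hy : y ∈ 𝓔 1) :
    β x (β y y) = (2 : K) • β y (β x y) := by
  rw [jacobi_even hx, skew_odd (bracket_mem_of_add_eq hx hy rfl) hy, two_smul]

/-- Of the four candidates of length 3, [y, [y, y]] vanishes and [x, [y, y]] is twice [y, [x, y]].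
-/
theorem evenOdd_two (h : TwoGenerated A x y) (h2 : (2 : K) ≠ 0) (h3 : (3 : K) ≠ 0)
    (hx : x ∈ 𝓔 0) (hy : y ∈ 𝓔 1) {T : Submodule K E} (ha : β x (β x y) ∈ T)
    (he : β y (β x y) ∈ T) (hT : 𝓒 3 ≤ T) : 𝓒 2 ≤ T := by
  refine h.step (k := 1) (S := {β x y, β y y}) ?_ ?_ ?_ hT
  · refine h.evenOdd_one h2 hx ?_ ?_ le_sup_right
    · exact Submodule.mem_sup_left (Submodule.mem_sup_left (Submodule.subset_span (by simp)))
    · exact Submodule.mem_sup_left (Submodule.mem_sup_left (Submodule.subset_span (by simp)))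
  · rintro _ (rfl | rfl)
    · exact ha
    · rw [bracket_even_sq hx hy]; exact Submodule.smul_mem _ _ he
  · rintro _ (rfl | rfl)
    · exact he
    · rw [bracket_cube_odd h3 hy]; exact zero_mem _

/-- If `[y, y]` lies in the third term of the lower central series modulo the centre, so does
`[y, [x, y]]` in the next one. -/
theorem evenOdd_mem_three (h : TwoGenerated A x y) (h2 : (2 : K) ≠ 0) (hx : x ∈ 𝓔 0)
    (hy : y ∈ 𝓔 1) (hc : β y y ∈ A ⊔ 𝓒 2) : β y (β x y) ∈ 𝓒 3 := by
  have h' := h.bracket_mem_of_mem_sup hc x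
  rw [bracket_even_sq hx hy] at h'
  exact (Submodule.smul_mem_iff _ h2).1 h'

/-- The case where `[x, [x, y]]`, `[y, e]` and `[y, [x, e]]` are central, `e = [y, [x, y]]`. -/
theorem evenOdd_finrank_le_seven (h : TwoGenerated A x y) (h2 : (2 : K) ≠ 0) (h3 : (3 : K) ≠ 0)
    (hx : x ∈ 𝓔 0) (hy : y ∈ 𝓔 1) (ha : β x (β x y) ∈ A) (he : β y (β y (β x y)) ∈ A)
    (hg : β y (β x (β y (β x y))) ∈ A) :
    Module.Finite K (𝓒 1) ∧ Module.finrank K (𝓒 1) ≤ 7 := by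
  have hb : β x y ∈ 𝓔 1 := bracket_mem_of_add_eq hx hy rfl
  -- Put b = [x, y]. Since [x, b] is central, [x, [y, b]] = [b, b], and applying ad x again only
  -- gives brackets with [x, b].
  have hxg : β x (β x (β y (β x y))) = 0 := by
    have e1 : β x (β y (β x y)) = β (β x y) (β x y) := by
      rw [jacobi_even hx, h.right _ ha, add_zero]
    rw [e1, jacobi_even hx, h.left _ ha, h.right _ ha, add_zero]
  have h3' : ∀ T : Submodule K E, β x (β y (β x y)) ∈ T → β y (β y (β x y)) ∈ T → 𝓒 4 ≤ T →
      𝓒 3 ≤ T := by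
    intro T hT1 hT2 hT
    refine h.step (k := 2) (S := {β y (β x y)}) ?_ (by simpa using hT1) (by simpa using hT2) hT
    refine h.evenOdd_two h2 h3 hx hy ?_ ?_ le_sup_right
    · exact Submodule.mem_sup_left (Submodule.mem_sup_right ha)
    · exact Submodule.mem_sup_left (Submodule.mem_sup_left (Submodule.subset_span (by simp)))
  have h4' : ∀ T : Submodule K E, β y (β x (β y (β x y))) ∈ T → 𝓒 5 ≤ T → 𝓒 4 ≤ T := by
    intro T hT1 hT
    refine h.step (k := 3) (S := {β x (β y (β x y))}) ?_ ?_ (by simpa using hT1) hT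
    · refine h3' _ ?_ ?_ le_sup_right
      · exact Submodule.mem_sup_left (Submodule.mem_sup_left (Submodule.subset_span (by simp)))
      · exact Submodule.mem_sup_left (Submodule.mem_sup_right he)
    · rintro _ rfl
      rw [hxg]; exact zero_mem _
  have h5' : 𝓒 5 = ⊥ := by
    exact h.lowerCentral_succ_eq_bot (h4' _ (Submodule.mem_sup_left hg) le_sup_right)
  have h1 : 𝓒 1 ≤ Submodule.span K (Set.range ![β x y, β y y, β x (β x y), β y (β x y),
      β x (β y (β x y)), β y (β y (β x y)), β y (β x (β y (β x y)))]) ⊔ (⊥ : Submodule K E) := by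
    rw [sup_bot_eq]
    refine h.evenOdd_one h2 hx (Submodule.subset_span ⟨0, rfl⟩) (Submodule.subset_span ⟨1, rfl⟩) ?_
    refine h.evenOdd_two h2 h3 hx hy (Submodule.subset_span ⟨2, rfl⟩)
      (Submodule.subset_span ⟨3, rfl⟩) ?_
    refine h3' _ (Submodule.subset_span ⟨4, rfl⟩) (Submodule.subset_span ⟨5, rfl⟩) ?_
    exact h4' _ (Submodule.subset_span ⟨6, rfl⟩) (h5'.le.trans bot_le)
  have := finite_and_finrank_le_of_le_span_sup _ h1
  rwa [finrank_bot, add_zero] at this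

/-- If `[y, y]` lies in the third term of the lower central series and `[x, [x, [x, y]]] = 0`, then
the fifth term vanishes. -/
theorem evenOdd_lowerCentral_four (h : TwoGenerated (⊥ : Submodule K E) x y) (h2 : (2 : K) ≠ 0)
    (h3 : (3 : K) ≠ 0) (hx : x ∈ 𝓔 0) (hy : y ∈ 𝓔 1) (hc : β y y ∈ 𝓒 2)
    (ha : β x (β x (β x y)) = 0) : 𝓒 4 = ⊥ := by
  have he := h.evenOdd_mem_three h2 hx hy (Submodule.mem_sup_right hc)
  have hb : β x y ∈ 𝓔 1 := bracket_mem_of_add_eq hx hy rfl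
  have ha' : β x (β x y) ∈ 𝓔 1 := bracket_mem_of_add_eq hx hb rfl
  have hc' : β y y ∈ 𝓔 0 := bracket_mem_of_add_eq hy hy rfl
  have he' : β y (β x y) ∈ 𝓔 0 := bracket_mem_of_add_eq hy hb rfl
  have hxb : β x y ∈ 𝓒 1 := bracket_mem_lowerCentral_one x y
  -- With c = [y, y] and a = [x, [x, y]], 2[y, [y, a]] = [c, a]. Expand by the derivation ad c:
  -- since [c, x] = -2[y, [x, y]] lies in C₃, each term lands in C₅.
  have hyg : β y (β y (β x (β x y))) ∈ 𝓒 5 := by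
    have e1 := bracket_bracket_self_odd hy (β x (β x y))
    have e2 : β (β y y) x = -((2 : K) • β y (β x y)) := by
      rw [skew_even hc', bracket_even_sq hx hy]
    have e3 : β (β y y) (β x y) = -((2 : K) • β (β y (β x y)) y) := by
      rw [jacobi_even hc', e2, skew_even hc' y, bracket_cube_odd h3 hy]
      simp
    have m3 : β (β y (β x y)) y ∈ 𝓒 4 := by
      rw [skew_even he']
      exact neg_mem (bracket_mem_lowerCentral y he)
    have m2 : β (β y (β x y)) (β x y) ∈ 𝓒 5 := by
      rw [skew_even he']
      exact neg_mem (bracket_derived_mem hxb he)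
    rw [jacobi_even hc', e2, e3] at e1
    refine (Submodule.smul_mem_iff _ h2).1 ?_
    rw [← e1]
    simp only [map_neg, map_smul, LinearMap.neg_apply, LinearMap.smul_apply]
    exact add_mem (neg_mem (Submodule.smul_mem _ _ m2))
      (neg_mem (Submodule.smul_mem _ _ (bracket_mem_lowerCentral x m3)))
  -- As [x, a] = 0, [x, [y, a]] = [[x, y], a]. Applying (ad x)³ to [y, y] ∈ C₂ gives six times this
  -- element, and 6 is invertible.
  have hxg : β x (β y (β x (β x y))) ∈ 𝓒 5 := by
    have e1 : β x (β x (β x (β y y))) = (2 : K) •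
        ((2 : K) • β (β x y) (β x (β x y)) + β x (β y (β x (β x y)))) := by
      rw [bracket_even_sq hx hy, map_smul, map_smul, jacobi_even hx y (β x y), map_add,
        jacobi_even hx (β x y) (β x y), skew_odd ha' hb, two_smul K (β (β x y) _)]
    have e2 : β x (β y (β x (β x y))) = β (β x y) (β x (β x y)) := by
      rw [jacobi_even hx y, ha, map_zero, add_zero]
    have m : β x (β x (β x (β y y))) ∈ 𝓒 5 :=
      bracket_mem_lowerCentral x (bracket_mem_lowerCentral x (bracket_mem_lowerCentral x hc))
    rw [e1, ← e2] at m
    have m' := (Submodule.smul_mem_iff _ h2).1 m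
    refine (Submodule.smul_mem_iff _ h3).1 ?_
    convert m' using 1
    module
  have c2 : 𝓒 2 ≤ Submodule.span K {β x (β x y)} ⊔ ⊥ ⊔ 𝓒 3 := by
    refine h.evenOdd_two h2 h3 hx hy ?_ (Submodule.mem_sup_right he) le_sup_right
    exact Submodule.mem_sup_left (Submodule.mem_sup_left (Submodule.subset_span (by simp)))
  have c3 : 𝓒 3 ≤ Submodule.span K {β y (β x (β x y))} ⊔ ⊥ ⊔ 𝓒 4 := by
    refine h.step c2 ?_ ?_ le_sup_right
    · rintro _ rfl
      rw [ha]; exact zero_mem _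
    · rintro _ rfl
      exact Submodule.mem_sup_left (Submodule.mem_sup_left (Submodule.subset_span (by simp)))
  -- C₃/C₄ is spanned by [y, a] alone, and both generators send it into C₅. So C₄ ≤ C₅.
  refine h.nil.eq_bot_of_le (h.step c3 ?_ ?_ le_rfl)
  · rintro _ rfl
    exact hxg
  · rintro _ rfl
    exact hyg

end EvenOdd

/-! ### Two odd generators. -/

section OddOdd

theorem oddOdd_one (h : TwoGenerated A x y) (hx : x ∈ 𝓔 1) (hy : y ∈ 𝓔 1)
    {T : Submodule K E} (hp : β x x ∈ T) (hq : β x y ∈ T) (hr : β y y ∈ T) (hT : 𝓒 2 ≤ T) :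
    𝓒 1 ≤ T := by
  refine h.step (k := 0) (S := {x, y}) h.gen ?_ ?_ hT
  · rintro _ (rfl | rfl) <;> assumption
  · rintro _ (rfl | rfl)
    · rw [skew_odd hy hx]; exact hq
    · exact hr

theorem bracket_odd_sq (hx : x ∈ 𝓔 1) (hy : y ∈ 𝓔 1) :
    β y (β x x) = -((2 : K) • β x (β x y)) := by
  rw [jacobi_odd hy hx, skew_odd hy hx, skew_even (bracket_mem_of_add_eq hx hy rfl)]
  module

theorem oddOdd_two (h : TwoGenerated A x y) (h3 : (3 : K) ≠ 0)
    (hx : x ∈ 𝓔 1) (hy : y ∈ 𝓔 1) {T : Submodule K E} (hu : β x (β x y) ∈ T)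
    (hv : β y (β x y) ∈ T) (hT : 𝓒 3 ≤ T) : 𝓒 2 ≤ T := by
  refine h.step (k := 1) (S := {β x x, β x y, β y y}) ?_ ?_ ?_ hT
  · refine h.oddOdd_one hx hy ?_ ?_ ?_ le_sup_right <;>
    exact Submodule.mem_sup_left (Submodule.mem_sup_left (Submodule.subset_span (by simp)))
  · rintro _ (rfl | rfl | rfl)
    · rw [bracket_cube_odd h3 hx]; exact zero_mem _
    · exact hu
    · rw [bracket_odd_sq hy hx, skew_odd hy hx]
      exact neg_mem (Submodule.smul_mem _ _ hv)
  · rintro _ (rfl | rfl | rfl)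
    · rw [bracket_odd_sq hx hy]
      exact neg_mem (Submodule.smul_mem _ _ hu)
    · exact hv
    · rw [bracket_cube_odd h3 hy]; exact zero_mem _

/-- A relation between `[x, x]`, `[x, y]` and `[y, y]` in degree two yields two relations between
`[x, [x, y]]` and `[y, [x, y]]` in degree three. -/
theorem oddOdd_relations (h : TwoGenerated A x y) (h3 : (3 : K) ≠ 0)
    (hx : x ∈ 𝓔 1) (hy : y ∈ 𝓔 1) {r s t : K}
    (hrel : r • β x x + s • β x y + t • β y y ∈ A ⊔ 𝓒 2) :
    s • β x (β x y) - (2 * t) • β y (β x y) ∈ 𝓒 3 ∧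
      s • β y (β x y) - (2 * r) • β x (β x y) ∈ 𝓒 3 := by
  have m1 := h.bracket_mem_of_mem_sup hrel x
  have m2 := h.bracket_mem_of_mem_sup hrel y
  simp only [map_add, map_smul] at m1 m2
  rw [bracket_cube_odd h3 hx, bracket_odd_sq hy hx, skew_odd hy hx] at m1
  rw [bracket_cube_odd h3 hy, bracket_odd_sq hx hy] at m2
  constructor
  · convert m1 using 1
    module
  · convert m2 using 1
    module

/-- The two relations of `oddOdd_relations` form a linear system in [x, [x, y]] and [y, [x, y]] with
determinant s² - 4rt. If it is invertible, both elements lie in C₃, so C₂ ≤ C₃. -/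
theorem oddOdd_lowerCentral_two (h : TwoGenerated A x y) (h3 : (3 : K) ≠ 0)
    (hx : x ∈ 𝓔 1) (hy : y ∈ 𝓔 1) {r s t : K}
    (hrel : r • β x x + s • β x y + t • β y y ∈ A ⊔ 𝓒 2) (hd : s * s - 4 * r * t ≠ 0) :
    𝓒 2 = ⊥ := by
  obtain ⟨m1, m2⟩ := h.oddOdd_relations h3 hx hy hrel
  refine h.nil.eq_bot_of_le (h.oddOdd_two h3 hx hy ?_ ?_ le_rfl)
  · refine (Submodule.smul_mem_iff _ hd).1 ?_
    convert add_mem (Submodule.smul_mem _ s m1) (Submodule.smul_mem _ (2 * t) m2) using 1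
    module
  · refine (Submodule.smul_mem_iff _ hd).1 ?_
    convert add_mem (Submodule.smul_mem _ s m2) (Submodule.smul_mem _ (2 * r) m1) using 1
    module

end OddOdd

end TwoGenerated

end LieSuperalgebra

namespace LieSuperalgebra

/-! ### Transfer along a central extension π : E → L. -/

section Hom

variable {K : Type u} {E : Type w} {L : Type v} [Field K] [AddCommGroup E] [Module K E]
  [LieSuperalgebra K E] [AddCommGroup L] [Module K L] [LieSuperalgebra K L]

local notation "β" => bracket (K := K) (L := E)
local notation "𝓔" => part (K := K) (L := E)
local notation "𝓒" => lowerCentral K E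

theorem Hom.isGraded_ker (π : Hom K E L) : IsGraded (LinearMap.ker π.toLinearMap) := by
  intro z hz
  obtain ⟨z₀, h₀, z₁, h₁, rfl⟩ := exists_add_eq (K := K) z
  rw [LinearMap.mem_ker, map_add] at hz
  obtain ⟨e₀, e₁⟩ := eq_and_eq_of_add_eq_add (π.map_part h₀) (π.map_part h₁)
    (zero_mem (part (K := K) (L := L) 0)) (zero_mem (part 1)) (hz.trans (add_zero 0).symm)
  exact add_mem (Submodule.mem_sup_left ⟨e₀, h₀⟩) (Submodule.mem_sup_right ⟨e₁, h₁⟩)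

theorem Hom.map_commutator (π : Hom K E L) (V W : Submodule K E) :
    (commutator V W).map π.toLinearMap =
      commutator (V.map π.toLinearMap) (W.map π.toLinearMap) := by
  apply le_antisymm
  · rw [Submodule.map_le_iff_le_comap]
    refine Submodule.map₂_le.2 fun p hp q hq => ?_
    change π.toLinearMap (β p q) ∈ commutator (V.map π.toLinearMap) (W.map π.toLinearMap)
    rw [π.map_bracket]
    exact Submodule.apply_mem_map₂ _ (Submodule.mem_map_of_mem hp) (Submodule.mem_map_of_mem hq)
  · refine Submodule.map₂_le.2 ?_
    rintro _ ⟨p, hp, rfl⟩ _ ⟨q, hq, rfl⟩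
    exact ⟨β p q, Submodule.apply_mem_map₂ _ hp hq, π.map_bracket p q⟩

variable {π : Hom K E L}

theorem Hom.map_lowerCentral (hπ : Function.Surjective π.toLinearMap) (k : ℕ) :
    (𝓒 k).map π.toLinearMap = lowerCentral K L k := by
  induction k with
  | zero => exact (Submodule.map_top _).trans (LinearMap.range_eq_top.2 hπ)
  | succ k ih =>
    have h := π.map_commutator ⊤ (𝓒 k)
    rwa [ih, Submodule.map_top, LinearMap.range_eq_top.2 hπ] at h

theorem Hom.mem_ker_sup_of_map_mem (hπ : Function.Surjective π.toLinearMap) {k : ℕ} {z : E}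
    (hz : π.toLinearMap z ∈ lowerCentral K L k) : z ∈ LinearMap.ker π.toLinearMap ⊔ 𝓒 k := by
  rw [← Hom.map_lowerCentral hπ] at hz
  obtain ⟨c, hc, e⟩ := hz
  refine Submodule.mem_sup.2 ⟨z - c, ?_, c, hc, sub_add_cancel _ _⟩
  rw [LinearMap.mem_ker, map_sub, e, sub_self]

theorem Hom.exists_mem_part (hπ : Function.Surjective π.toLinearMap) {i : ZMod 2} {x : L}
    (hx : x ∈ part (K := K) (L := L) i) : ∃ z ∈ 𝓔 i, π.toLinearMap z = x := by
  obtain ⟨z, rfl⟩ := hπ x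
  obtain ⟨z₀, h₀, z₁, h₁, rfl⟩ := exists_add_eq (K := K) z
  have h01 : ∀ i : ZMod 2, i = 0 ∨ i = 1 := by decide
  rw [map_add] at hx ⊢
  rcases h01 i with rfl | rfl
  · obtain ⟨e, -⟩ := eq_and_eq_of_add_eq_add (π.map_part h₀) (π.map_part h₁) hx
      (zero_mem (part (K := K) (L := L) 1)) (add_zero _).symm
    exact ⟨z₀, h₀, e⟩
  · obtain ⟨-, e⟩ := eq_and_eq_of_add_eq_add (π.map_part h₀) (π.map_part h₁)
      (zero_mem (part (K := K) (L := L) 0)) hx (zero_add _).symm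
    exact ⟨z₁, h₁, e⟩

/-- Skew-symmetry holds only for homogeneous elements, so this needs the kernel to be graded. -/
theorem bracket_ker_eq_zero (hc : ∀ a ∈ LinearMap.ker π.toLinearMap, ∀ z, β a z = 0)
    {a : E} (ha : a ∈ LinearMap.ker π.toLinearMap) (z : E) : β z a = 0 := by
  obtain ⟨a₀, h₀, a₁, h₁, h₀', h₁', rfl⟩ := π.isGraded_ker.exists_add_eq ha
  obtain ⟨z₀, hz₀, z₁, hz₁, rfl⟩ := exists_add_eq (K := K) z
  simp only [map_add, LinearMap.add_apply]
  rw [skew hz₀ h₀', skew hz₀ h₁', skew hz₁ h₀', skew hz₁ h₁', hc a₀ h₀, hc a₀ h₀, hc a₁ h₁,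
    hc a₁ h₁]
  simp

theorem TwoGenerated.of_hom (hπ : Function.Surjective π.toLinearMap)
    (hc : ∀ a ∈ LinearMap.ker π.toLinearMap, ∀ z, β a z = 0) {x y : E}
    (h : TwoGenerated (⊥ : Submodule K L) (π.toLinearMap x) (π.toLinearMap y)) :
    TwoGenerated (LinearMap.ker π.toLinearMap) x y where
  left := hc
  right a ha z := bracket_ker_eq_zero hc ha z
  gen := by
    intro z _
    have hz := h.gen (Submodule.mem_top (x := π.toLinearMap z))
    rw [sup_bot_eq] at hz
    obtain ⟨p, hp, q, hq, e⟩ := Submodule.mem_sup.1 hz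
    rw [← Set.image_pair, ← Submodule.map_span] at hp
    obtain ⟨p', hp', rfl⟩ := hp
    have hq' : π.toLinearMap (z - p') ∈ lowerCentral K L 1 := by
      rw [map_sub, ← e, add_sub_cancel_left]; exact hq
    have := Hom.mem_ker_sup_of_map_mem hπ hq'
    rw [sup_assoc]
    exact Submodule.mem_sup.2 ⟨p', hp', _, this, add_sub_cancel _ _⟩
  nil := by
    obtain ⟨N, hN⟩ := h.nil
    -- The N-th term of E maps to zero in L, hence is central; one more bracket kills it.
    refine ⟨N + 1, le_bot_iff.1 (Submodule.map₂_le.2 fun p _ q hq => ?_)⟩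
    refine bracket_ker_eq_zero hc ?_ p
    have := Submodule.mem_map_of_mem (f := π.toLinearMap) hq
    rwa [Hom.map_lowerCentral hπ, hN] at this

/-- Each of ad x and ad y annihilates the kernel, so it factors through L and its image of Cₖ(E) is
no larger than Cₖ(L). -/
theorem TwoGenerated.finrank_lowerCentral_succ_le [Module.Finite K L]
    (hπ : Function.Surjective π.toLinearMap) {x y : E}
    (h : TwoGenerated (LinearMap.ker π.toLinearMap) x y) (k : ℕ) :
    Module.Finite K (𝓒 (k + 1)) ∧
      Module.finrank K (𝓒 (k + 1)) ≤ 2 * Module.finrank K (lowerCentral K L k) := by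
  obtain ⟨f1, r1⟩ := finite_and_finrank_map_le π.toLinearMap hπ (β x)
    (fun a ha => h.right a ha x) (𝓒 k)
  obtain ⟨f2, r2⟩ := finite_and_finrank_map_le π.toLinearMap hπ (β y)
    (fun a ha => h.right a ha y) (𝓒 k)
  rw [Hom.map_lowerCentral hπ] at r1 r2
  have hle := h.lowerCentral_succ_le_map k
  refine ⟨Submodule.finiteDimensional_of_le hle, (Submodule.finrank_mono hle).trans ?_⟩
  have := Submodule.finrank_add_le_finrank_add_finrank ((𝓒 k).map (β x)) ((𝓒 k).map (β y))
  omega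

end Hom

/-! ### Counting odd dimensions along the lower central series. -/

section Dimension

variable {K : Type u} {L : Type v} [Field K] [AddCommGroup L] [Module K L] [LieSuperalgebra K L]

local notation "𝓛" => part (K := K) (L := L)
local notation "𝓒" => lowerCentral K L

theorem finrank_odd_inf_add_one_le [Module.Finite K L] {V W : Submodule K L} (h : W ≤ V) {z : L} (hz : z ∈ 𝓛 1)
    (hzV : z ∈ V) (hzW : z ∉ W) :
    Module.finrank K (𝓛 1 ⊓ W : Submodule K L) + 1 ≤
      Module.finrank K (𝓛 1 ⊓ V : Submodule K L) :=
  finrank_add_one_le (inf_le_inf_left _ h) ⟨hz, hzV⟩ fun h => hzW h.2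

theorem eq_zero_of_finrank_odd_inf [Module.Finite K L] {V : Submodule K L}
    (h : Module.finrank K (𝓛 1 ⊓ V : Submodule K L) = 0) {z : L} (hz : z ∈ 𝓛 1) (hzV : z ∈ V) :
    z = 0 := by
  rw [Submodule.finrank_eq_zero] at h
  exact (Submodule.mem_bot K).1 (h ▸ ⟨hz, hzV⟩)

variable (K L) in
theorem finrank_odd_inf_lowerCentral_zero :
    Module.finrank K (𝓛 1 ⊓ 𝓒 0 : Submodule K L) = Module.finrank K (𝓛 1) := by
  have : 𝓛 1 ⊓ 𝓒 0 = 𝓛 1 := inf_top_eq _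
  rw [this]

end Dimension

/-! ### The bound on E² for each parity of the generators. -/

section Bounds

variable {K : Type u} {E : Type w} {L : Type v} [Field K] [AddCommGroup E] [Module K E]
  [LieSuperalgebra K E] [AddCommGroup L] [Module K L] [LieSuperalgebra K L] [Module.Finite K L]
  {π : Hom K E L}

local notation "β" => bracket (K := K) (L := E)
local notation "βL" => bracket (K := K) (L := L)
local notation "𝓔" => part (K := K) (L := E)
local notation "𝓒" => lowerCentral K E
local notation "𝓒L" => lowerCentral K L
local notation "ϖ" => Hom.toLinearMap π

theorem finrank_derived_le_of_even_odd (h2 : (2 : K) ≠ 0) (h3 : (3 : K) ≠ 0)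
    (hπ : Function.Surjective ϖ) (hc : ∀ a ∈ LinearMap.ker ϖ, ∀ z, β a z = 0) {x y : E}
    (hx : x ∈ 𝓔 0) (hy : y ∈ 𝓔 1) (h : TwoGenerated (⊥ : Submodule K L) (ϖ x) (ϖ y))
    (hind : ∀ r s : K, r • ϖ x + s • ϖ y ∈ 𝓒L 1 → r = 0 ∧ s = 0) {m n : ℕ}
    (hn : Module.finrank K (part 1 : Submodule K L) = n) (hmn : 6 ≤ m + n)
    (hder : Module.finrank K (𝓒L 1) + 2 = m + n) :
    Module.Finite K (𝓒 1) ∧ Module.finrank K (𝓒 1) + 7 ≤ 2 * m + 3 * n := by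
  have hE := TwoGenerated.of_hom hπ hc h
  have hx' := π.map_part hx
  have hy' := π.map_part hy
  set X := ϖ x with hX
  set Y := ϖ y with hY
  have hB : βL X Y ∈ part (K := K) (L := L) 1 := bracket_mem_of_add_eq hx' hy' rfl
  have hA : βL X (βL X Y) ∈ part (K := K) (L := L) 1 := bracket_mem_of_add_eq hx' hB rfl
  have hE' : βL Y (βL X Y) ∈ part (K := K) (L := L) 0 := bracket_mem_of_add_eq hy' hB rfl
  have mB : βL X Y ∈ 𝓒L 1 := bracket_mem_lowerCentral_one _ _
  have mA : βL X (βL X Y) ∈ 𝓒L 2 := bracket_mem_lowerCentral _ mB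
  have mE : βL Y (βL X Y) ∈ 𝓒L 2 := bracket_mem_lowerCentral _ mB
  have mA' : βL X (βL X (βL X Y)) ∈ 𝓒L 3 := bracket_mem_lowerCentral _ mA
  have hy1 : Y ∉ 𝓒L 1 := fun hm => one_ne_zero (hind 0 1 (by simpa using hm)).2
  -- This is where m+n ≥ 6 enters: L² has dimension at least 4.
  have small : ∀ (k : ℕ) (s : Fin k → L), 𝓒L 1 ≤ Submodule.span K (Set.range s) ⊔ ⊥ → 4 ≤ k := by
    intro k s hs
    have := (finite_and_finrank_le_of_le_span_sup s hs).2
    rw [finrank_bot] at this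
    omega
  have hb2 : βL X Y ∉ 𝓒L 2 := by
    intro hm
    have e : 𝓒L 2 = ⊥ := h.nil.eq_bot_of_le (h.evenOdd_two h2 h3 hx' hy'
      (bracket_mem_lowerCentral _ hm) (bracket_mem_lowerCentral _ hm) le_rfl)
    have := small 1 ![βL Y Y] (h.evenOdd_one h2 hx' (Submodule.mem_sup_right (e ▸ hm))
      (Submodule.mem_sup_left (Submodule.subset_span ⟨0, rfl⟩)) (e.le.trans bot_le))
    omega
  have n1 := finrank_odd_inf_add_one_le (V := 𝓒L 0) le_top hy' trivial hy1
  have n2 := finrank_odd_inf_add_one_le (W := 𝓒L 2) (lowerCentral_succ_le 1) hB mB hb2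
  rw [finrank_odd_inf_lowerCentral_zero, hn] at n1
  obtain ⟨f3, r3⟩ : Module.Finite K (𝓒 3) ∧
      Module.finrank K (𝓒 3) ≤ 2 * Module.finrank K (𝓒L 2) :=
    hE.finrank_lowerCentral_succ_le hπ 2
  -- Here Y and [X, Y] exhaust the odd part, so C₂(L) is purely even and the odd brackets below lift
  -- to central elements. As n = 2 and m ≥ 4, the bound seven fits: 14 ≤ 2m+3n.
  by_cases hn2 : n ≤ 2
  · have z2 : ∀ z ∈ part (K := K) (L := L) 1, z ∈ 𝓒L 2 → z = 0 := fun z hz hz' =>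
      eq_zero_of_finrank_odd_inf (by omega) hz hz'
    have mXE : βL X (βL Y (βL X Y)) ∈ 𝓒L 3 := bracket_mem_lowerCentral _ mE
    have hXE : βL X (βL Y (βL X Y)) ∈ part (K := K) (L := L) 0 := bracket_mem_of_add_eq hx' hE' rfl
    obtain ⟨f, hf⟩ := hE.evenOdd_finrank_le_seven h2 h3 hx hy
      (by
        rw [LinearMap.mem_ker, π.map_bracket, π.map_bracket]
        exact z2 _ hA mA)
      (by
        rw [LinearMap.mem_ker, π.map_bracket, π.map_bracket, π.map_bracket]
        exact z2 _ (bracket_mem_of_add_eq hy' hE' rfl)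
          (lowerCentral_succ_le 2 (bracket_mem_lowerCentral _ mE)))
      (by
        rw [LinearMap.mem_ker, π.map_bracket, π.map_bracket, π.map_bracket, π.map_bracket]
        exact z2 _ (bracket_mem_of_add_eq hy' hXE rfl)
          (lowerCentral_antitone (by omega : 2 ≤ 4) (bracket_mem_lowerCentral _ mXE)))
    exact ⟨f, by omega⟩
  by_cases hc2 : βL Y Y ∈ 𝓒L 2
  · have hcE : β y y ∈ LinearMap.ker ϖ ⊔ 𝓒 2 :=
      Hom.mem_ker_sup_of_map_mem hπ (by rw [π.map_bracket]; exact hc2)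
    have he := hE.evenOdd_mem_three h2 hx hy hcE
    have heL := h.evenOdd_mem_three h2 hx' hy' (Submodule.mem_sup_right hc2)
    have hle : 𝓒 1 ≤ Submodule.span K (Set.range ![β x y, β y y, β x (β x y)]) ⊔ 𝓒 3 := by
      refine hE.evenOdd_one h2 hx (Submodule.mem_sup_left (Submodule.subset_span ⟨0, rfl⟩))
        (Submodule.mem_sup_left (Submodule.subset_span ⟨1, rfl⟩)) ?_
      exact hE.evenOdd_two h2 h3 hx hy (Submodule.mem_sup_left (Submodule.subset_span ⟨2, rfl⟩))
        (Submodule.mem_sup_right he) le_sup_right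
    obtain ⟨f, hf⟩ := finite_and_finrank_le_of_le_span_sup _ hle
    have hd := finrank_add_one_le (W := 𝓒L 2) (lowerCentral_succ_le 1) mB hb2
    -- The count is 3 + 2(d-1) = 2m+2n-3, which suffices for n ≥ 4. If n = 3, then Y, [X, Y], [X,
    -- [X, Y]] use up the odd part, so C₃(L) is even and [X, [X, [X, Y]]] = 0. This forces C₄(L) = 0
    -- and dim L² ≤ 3, a contradiction.
    by_cases hn3 : n ≤ 3
    · exfalso
      have ha3 : βL X (βL X Y) ∉ 𝓒L 3 := by
        intro hm
        have e : 𝓒L 2 = ⊥ := h.nil.eq_bot_of_le (h.evenOdd_two h2 h3 hx' hy' hm heL le_rfl)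
        have := small 2 ![βL X Y, βL Y Y] (h.evenOdd_one h2 hx'
          (Submodule.mem_sup_left (Submodule.subset_span ⟨0, rfl⟩))
          (Submodule.mem_sup_left (Submodule.subset_span ⟨1, rfl⟩)) (e.le.trans bot_le))
        omega
      have n3 := finrank_odd_inf_add_one_le (W := 𝓒L 3) (lowerCentral_succ_le 2) hA mA ha3
      have ha0 : βL X (βL X (βL X Y)) = 0 :=
        eq_zero_of_finrank_odd_inf (by omega) (bracket_mem_of_add_eq hx' hA rfl) mA'
      have e4 := h.evenOdd_lowerCentral_four h2 h3 hx' hy' hc2 ha0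
      have h3le : ∀ T : Submodule K L, βL Y (βL X (βL X Y)) ∈ T → 𝓒L 3 ≤ T := by
        intro T hT
        refine h.step (k := 2) (S := {βL X (βL X Y)}) ?_ ?_ (by simpa using hT)
          (e4.le.trans bot_le)
        · refine h.evenOdd_two h2 h3 hx' hy' ?_ (Submodule.mem_sup_right heL) le_sup_right
          exact Submodule.mem_sup_left (Submodule.mem_sup_left (Submodule.subset_span (by simp)))
        · rintro _ rfl
          rw [ha0]; exact zero_mem _
      have h2le : 𝓒L 1 ≤ Submodule.span K
          (Set.range ![βL X Y, βL X (βL X Y), βL Y (βL X (βL X Y))]) ⊔ ⊥ := by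
        rw [sup_bot_eq]
        have h3' : 𝓒L 3 ≤ Submodule.span K
            (Set.range ![βL X Y, βL X (βL X Y), βL Y (βL X (βL X Y))]) :=
          h3le _ (Submodule.subset_span ⟨2, rfl⟩)
        have h2' : 𝓒L 2 ≤ Submodule.span K
            (Set.range ![βL X Y, βL X (βL X Y), βL Y (βL X (βL X Y))]) :=
          h.evenOdd_two h2 h3 hx' hy' (Submodule.subset_span ⟨1, rfl⟩) (h3' heL) h3'
        exact h.evenOdd_one h2 hx' (Submodule.subset_span ⟨0, rfl⟩) (h2' hc2) h2'
      have := small 3 _ h2le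
      omega
    · exact ⟨f, by omega⟩
  · have hle : 𝓒 1 ≤ Submodule.span K
        (Set.range ![β x y, β y y, β x (β x y), β y (β x y)]) ⊔ 𝓒 3 := by
      refine hE.evenOdd_one h2 hx (Submodule.mem_sup_left (Submodule.subset_span ⟨0, rfl⟩))
        (Submodule.mem_sup_left (Submodule.subset_span ⟨1, rfl⟩)) ?_
      exact hE.evenOdd_two h2 h3 hx hy (Submodule.mem_sup_left (Submodule.subset_span ⟨2, rfl⟩))
        (Submodule.mem_sup_left (Submodule.subset_span ⟨3, rfl⟩)) le_sup_right
    obtain ⟨f, hf⟩ := finite_and_finrank_le_of_le_span_sup _ hle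
    -- [Y, Y] is even and [X, Y] odd, so a relation between them modulo the graded C₂(L) splits into
    -- two. The count becomes 4 + 2(d-2) = 2d.
    have hC : βL Y Y ∈ part (K := K) (L := L) 0 := bracket_mem_of_add_eq hy' hy' rfl
    have hd := finrank_add_two_le (W := 𝓒L 2) (lowerCentral_succ_le 1)
      (bracket_mem_lowerCentral_one Y Y : βL Y Y ∈ 𝓒L 1) mB (by
        intro r s hrs
        obtain ⟨m1, m2⟩ := (isGraded_lowerCentral 2).mem_and_mem (Submodule.smul_mem _ r hC)
          (Submodule.smul_mem _ s hB) hrs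
        constructor
        · by_contra hr
          exact hc2 ((Submodule.smul_mem_iff _ hr).1 m1)
        · by_contra hs
          exact hb2 ((Submodule.smul_mem_iff _ hs).1 m2))
    exact ⟨f, by omega⟩

theorem finrank_derived_le_of_odd_odd (h2 : (2 : K) ≠ 0) (h3 : (3 : K) ≠ 0)
    (hπ : Function.Surjective ϖ) (hc : ∀ a ∈ LinearMap.ker ϖ, ∀ z, β a z = 0) {x y : E}
    (hx : x ∈ 𝓔 1) (hy : y ∈ 𝓔 1) (h : TwoGenerated (⊥ : Submodule K L) (ϖ x) (ϖ y))
    (hind : ∀ r s : K, r • ϖ x + s • ϖ y ∈ 𝓒L 1 → r = 0 ∧ s = 0) {m n : ℕ}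
    (hn : Module.finrank K (part 1 : Submodule K L) = n) (hmn : 6 ≤ m + n)
    (hder : Module.finrank K (𝓒L 1) + 2 = m + n) :
    Module.Finite K (𝓒 1) ∧ Module.finrank K (𝓒 1) + 7 ≤ 2 * m + 3 * n := by
  have hE := TwoGenerated.of_hom hπ hc h
  have hx' := π.map_part hx
  have hy' := π.map_part hy
  set X := ϖ x with hX
  set Y := ϖ y with hY
  have mP : βL X X ∈ 𝓒L 1 := bracket_mem_lowerCentral_one _ _
  have mQ : βL X Y ∈ 𝓒L 1 := bracket_mem_lowerCentral_one _ _
  have mR : βL Y Y ∈ 𝓒L 1 := bracket_mem_lowerCentral_one _ _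
  have hQ : βL X Y ∈ part (K := K) (L := L) 0 := bracket_mem_of_add_eq hx' hy' rfl
  have h4 : (4 : K) ≠ 0 := by
    have : (4 : K) = 2 * 2 := by norm_num
    rw [this]; exact mul_ne_zero h2 h2
  have c2 : 𝓒L 2 ≠ ⊥ := by
    intro e
    have hle : 𝓒L 1 ≤ Submodule.span K (Set.range ![βL X X, βL X Y, βL Y Y]) ⊔ ⊥ :=
      h.oddOdd_one hx' hy' (Submodule.mem_sup_left (Submodule.subset_span ⟨0, rfl⟩))
        (Submodule.mem_sup_left (Submodule.subset_span ⟨1, rfl⟩))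
        (Submodule.mem_sup_left (Submodule.subset_span ⟨2, rfl⟩)) (e.le.trans bot_le)
    have := (finite_and_finrank_le_of_le_span_sup _ hle).2
    rw [finrank_bot] at this
    omega
  have n2 := finrank_add_two_le (V := 𝓒L 0 ⊓ part 1) (W := 𝓒L 1 ⊓ part 1)
    (inf_le_inf_right _ (lowerCentral_succ_le 0)) (b := X) (c := Y) ⟨trivial, hx'⟩ ⟨trivial, hy'⟩
    fun r s hrs => hind r s hrs.1
  rw [inf_comm, inf_comm (𝓒L 0), finrank_odd_inf_lowerCentral_zero, hn] at n2
  -- X and Y take two odd dimensions outside L². If n = 2, L² is even, so the odd brackets of length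
  -- 3 vanish and C₂(L) = 0.
  have hn3 : 3 ≤ n := by
    by_contra hn3
    have z : ∀ w, βL w (βL X Y) ∈ part (K := K) (L := L) 1 → βL w (βL X Y) = 0 := fun w hw =>
      eq_zero_of_finrank_odd_inf (V := 𝓒L 1) (by omega) hw (bracket_mem_lowerCentral_one _ _)
    refine c2 (h.nil.eq_bot_of_le (h.oddOdd_two h3 hx' hy' ?_ ?_ le_rfl))
    · rw [z X (bracket_mem_of_add_eq hx' hQ rfl)]; exact zero_mem _
    · rw [z Y (bracket_mem_of_add_eq hy' hQ rfl)]; exact zero_mem _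
  obtain ⟨f3, r3⟩ : Module.Finite K (𝓒 3) ∧
      Module.finrank K (𝓒 3) ≤ 2 * Module.finrank K (𝓒L 2) :=
    hE.finrank_lowerCentral_succ_le hπ 2
  -- Without a relation the count is 5 + 2(d-3); with one it is 4 + 2(d-2).
  by_cases hrel : ∀ r s t : K, r • βL X X + s • βL X Y + t • βL Y Y ∈ 𝓒L 2 →
      r = 0 ∧ s = 0 ∧ t = 0
  · have hle : 𝓒 1 ≤ Submodule.span K
        (Set.range ![β x x, β x y, β y y, β x (β x y), β y (β x y)]) ⊔ 𝓒 3 := by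
      refine hE.oddOdd_one hx hy (Submodule.mem_sup_left (Submodule.subset_span ⟨0, rfl⟩))
        (Submodule.mem_sup_left (Submodule.subset_span ⟨1, rfl⟩))
        (Submodule.mem_sup_left (Submodule.subset_span ⟨2, rfl⟩)) ?_
      exact hE.oddOdd_two h3 hx hy (Submodule.mem_sup_left (Submodule.subset_span ⟨3, rfl⟩))
        (Submodule.mem_sup_left (Submodule.subset_span ⟨4, rfl⟩)) le_sup_right
    obtain ⟨f, hf⟩ := finite_and_finrank_le_of_le_span_sup _ hle
    have hd := finrank_add_three_le (W := 𝓒L 2) (lowerCentral_succ_le 1) mP mQ mR hrel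
    exact ⟨f, by omega⟩
  · push Not at hrel
    obtain ⟨r, s, t, hrst, hne⟩ := hrel
    have disc : ∀ r s t : K, r • βL X X + s • βL X Y + t • βL Y Y ∈ 𝓒L 2 →
        s * s - 4 * r * t = 0 := by
      intro r s t hm
      by_contra hd
      exact c2 (h.oddOdd_lowerCentral_two h3 hx' hy' (Submodule.mem_sup_right hm) hd)
    -- All relations lie on the conic s² = 4rt, which contains no two independent vectors together
    -- with their span. So L²/C₂(L) has dimension at least 2.
    have hd : Module.finrank K (𝓒L 2) + 2 ≤ Module.finrank K (𝓒L 1) := by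
      by_cases hP : βL X X ∈ 𝓒L 2
      · refine finrank_add_two_le (W := 𝓒L 2) (lowerCentral_succ_le 1) mQ mR fun s t hm => ?_
        have hs : s = 0 := by simpa using disc 0 s t (by simpa using hm)
        refine ⟨hs, ?_⟩
        have := disc 1 0 t (by
          rw [hs, zero_smul, zero_add] at hm
          simpa using add_mem hP hm)
        simpa [h4] using this
      · refine finrank_add_two_le (W := 𝓒L 2) (lowerCentral_succ_le 1) mP mQ fun r s hm => ?_
        have hs : s = 0 := by simpa using disc r s 0 (by simpa using hm)
        refine ⟨?_, hs⟩
        by_contra hr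
        rw [hs, zero_smul, add_zero] at hm
        exact hP ((Submodule.smul_mem_iff _ hr).1 hm)
    have hrelE : r • β x x + s • β x y + t • β y y ∈ LinearMap.ker ϖ ⊔ 𝓒 2 := by
      refine Hom.mem_ker_sup_of_map_mem hπ ?_
      simp only [map_add, map_smul, π.map_bracket]
      exact hrst
    obtain ⟨m1, m2⟩ := hE.oddOdd_relations h3 hx hy hrelE
    -- Some coefficient r, s or t is nonzero, so `m1` or `m2` expresses one of [x, [x, y]], [y, [x,
    -- y]] through the other modulo C₃.
    have hw : ∃ w : E, 𝓒 2 ≤ Submodule.span K {w} ⊔ 𝓒 3 := by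
      have aux : ∀ {p q : E} {c d : K}, c ≠ 0 → c • p - d • q ∈ 𝓒 3 →
          p ∈ Submodule.span K {q} ⊔ 𝓒 3 := by
        intro p q c d hc hm
        refine (Submodule.smul_mem_iff _ hc).1 ?_
        rw [← add_sub_cancel (d • q) (c • p)]
        exact add_mem (Submodule.mem_sup_left
          (Submodule.smul_mem _ _ (Submodule.mem_span_singleton_self q)))
          (Submodule.mem_sup_right hm)
      by_cases hs : s = 0
      · by_cases hr : r = 0
        · have ht := hne hr hs
          refine ⟨β x (β x y), hE.oddOdd_two h3 hx hy
            (Submodule.mem_sup_left (Submodule.mem_span_singleton_self _)) ?_ le_sup_right⟩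
          refine aux (c := 2 * t) (d := s) (mul_ne_zero h2 ht) ?_
          rw [← neg_sub]; exact neg_mem m1
        · refine ⟨β y (β x y), hE.oddOdd_two h3 hx hy ?_
            (Submodule.mem_sup_left (Submodule.mem_span_singleton_self _)) le_sup_right⟩
          refine aux (c := 2 * r) (d := s) (mul_ne_zero h2 hr) ?_
          rw [← neg_sub]; exact neg_mem m2
      · exact ⟨β y (β x y), hE.oddOdd_two h3 hx hy (aux hs m1)
          (Submodule.mem_sup_left (Submodule.mem_span_singleton_self _)) le_sup_right⟩
    obtain ⟨w, hw⟩ := hw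
    have hle : 𝓒 1 ≤ Submodule.span K (Set.range ![β x x, β x y, β y y, w]) ⊔ 𝓒 3 := by
      refine hE.oddOdd_one hx hy (Submodule.mem_sup_left (Submodule.subset_span ⟨0, rfl⟩))
        (Submodule.mem_sup_left (Submodule.subset_span ⟨1, rfl⟩))
        (Submodule.mem_sup_left (Submodule.subset_span ⟨2, rfl⟩)) (hw.trans ?_)
      refine sup_le_sup_right (Submodule.span_le.2 ?_) _
      rintro _ rfl
      exact Submodule.subset_span ⟨3, rfl⟩
    obtain ⟨f, hf⟩ := finite_and_finrank_le_of_le_span_sup _ hle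
    exact ⟨f, by omega⟩

end Bounds

end LieSuperalgebra

namespace LieSuperalgebra

/-! ### Quotients by graded ideals. -/

section Quotient

variable {K : Type u} {E : Type w} {L : Type v} [Field K] [AddCommGroup E] [Module K E]
  [LieSuperalgebra K E] [AddCommGroup L] [Module K L] [LieSuperalgebra K L]

local notation "β" => bracket (K := K) (L := E)
local notation "𝓔" => part (K := K) (L := E)

/-- The bracket induced on the quotient by a two-sided ideal. -/
def quotientBracket (I : Submodule K E) (hl : ∀ z, ∀ a ∈ I, β z a ∈ I)
    (hr : ∀ a ∈ I, ∀ z, β a z ∈ I) : (E ⧸ I) →ₗ[K] (E ⧸ I) →ₗ[K] (E ⧸ I) :=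
  I.liftQ ((I.liftQ (LinearMap.compr₂ β I.mkQ).flip (by
    intro a ha
    refine LinearMap.ext fun z => ?_
    exact (Submodule.Quotient.mk_eq_zero _).2 (hl z a ha))).flip) (by
  intro a ha
  refine LinearMap.ext fun t => ?_
  obtain ⟨z, rfl⟩ := I.mkQ_surjective t
  exact (Submodule.Quotient.mk_eq_zero _).2 (hr a ha z))

theorem quotientBracket_mkQ (I : Submodule K E) (hl : ∀ z, ∀ a ∈ I, β z a ∈ I)
    (hr : ∀ a ∈ I, ∀ z, β a z ∈ I) (p q : E) :
    quotientBracket I hl hr (I.mkQ p) (I.mkQ q) = I.mkQ (β p q) := rfl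

/-- The quotient of a Lie superalgebra by a graded ideal. -/
abbrev quotient (I : Submodule K E) (hI : IsGraded I) (hl : ∀ z, ∀ a ∈ I, β z a ∈ I)
    (hr : ∀ a ∈ I, ∀ z, β a z ∈ I) : LieSuperalgebra K (E ⧸ I) where
  bracket := quotientBracket I hl hr
  part i := (𝓔 i).map I.mkQ
  isCompl := by
    constructor
    · rw [Submodule.disjoint_def]
      rintro _ ⟨p, hp, rfl⟩ ⟨q, hq, h⟩
      have hpq : p + -q ∈ I := by
        rw [← Submodule.ker_mkQ I, LinearMap.mem_ker, map_add, map_neg, h, add_neg_cancel]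
      exact (Submodule.Quotient.mk_eq_zero _).2 (hI.mem_and_mem hp (neg_mem hq) hpq).1
    · rw [codisjoint_iff, ← Submodule.map_sup,
        codisjoint_iff.1 (isCompl (K := K) (L := E)).codisjoint, Submodule.map_top,
        Submodule.range_mkQ]
  bracket_mem := by
    rintro i j _ _ ⟨p, hp, rfl⟩ ⟨q, hq, rfl⟩
    exact ⟨_, bracket_mem hp hq, rfl⟩
  skew := by
    rintro i j _ _ ⟨p, hp, rfl⟩ ⟨q, hq, rfl⟩
    rw [quotientBracket_mkQ, quotientBracket_mkQ, skew hp hq, map_neg, map_smul]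
  jacobi := by
    rintro i j k _ _ _ ⟨p, hp, rfl⟩ ⟨q, hq, rfl⟩ ⟨r, hr, rfl⟩
    simp only [quotientBracket_mkQ]
    rw [jacobi hp hq hr, map_add, map_smul]

/-- A homomorphism that vanishes on a graded ideal descends to the quotient. -/
def Hom.quotientLift (π : Hom K E L) (I : Submodule K E) (hI : IsGraded I)
    (hl : ∀ z, ∀ a ∈ I, β z a ∈ I) (hr : ∀ a ∈ I, ∀ z, β a z ∈ I)
    (hle : I ≤ LinearMap.ker π.toLinearMap) :
    letI := quotient I hI hl hr
    Hom K (E ⧸ I) L :=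
  letI := quotient I hI hl hr
  { toLinearMap := I.liftQ π.toLinearMap hle
    map_part := by
      rintro i _ ⟨p, hp, rfl⟩
      exact π.map_part hp
    map_bracket := by
      intro p q
      obtain ⟨p, rfl⟩ := I.mkQ_surjective p
      obtain ⟨q, rfl⟩ := I.mkQ_surjective q
      exact π.map_bracket p q }

/-- The projection onto the quotient by a graded ideal. -/
def quotientProj (I : Submodule K E) (hI : IsGraded I)
    (hl : ∀ z, ∀ a ∈ I, β z a ∈ I) (hr : ∀ a ∈ I, ∀ z, β a z ∈ I) :
    letI := quotient I hI hl hr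
    Hom K E (E ⧸ I) :=
  letI := quotient I hI hl hr
  { toLinearMap := I.mkQ
    map_part := fun hp => ⟨_, hp, rfl⟩
    map_bracket := fun _ _ => rfl }

end Quotient

/-! ### Homogeneous generators, and the bound for an arbitrary central extension. -/

section Generators

variable {K : Type u} {L : Type v} [Field K] [AddCommGroup L] [Module K L] [LieSuperalgebra K L]

local notation "𝓛" => part (K := K) (L := L)

theorem exists_homogeneous_notMem {W : Submodule K L} (hW : W ≠ ⊤) :
    ∃ i, ∃ x ∈ 𝓛 i, x ∉ W := by
  by_contra! h
  refine hW (top_le_iff.1 ?_)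
  rw [← codisjoint_iff.1 (isCompl (K := K) (L := L)).codisjoint]
  exact sup_le (h 0) (h 1)

theorem exists_homogeneous_generators [Module.Finite K L] {W : Submodule K L}
    (hW : Module.finrank K W + 2 = Module.finrank K L) :
    ∃ i, ∃ x ∈ 𝓛 i, ∃ j, ∃ y ∈ 𝓛 j, ⊤ ≤ Submodule.span K {x, y} ⊔ W ∧
      ∀ r s : K, r • x + s • y ∈ W → r = 0 ∧ s = 0 := by
  obtain ⟨i, x, hx, hxW⟩ := exists_homogeneous_notMem (K := K) (W := W) (by
    rintro rfl
    rw [finrank_top] at hW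
    omega)
  have h1 := finrank_add_one_le (le_sup_right : W ≤ Submodule.span K {x} ⊔ W)
    (Submodule.mem_sup_left (Submodule.mem_span_singleton_self x)) hxW
  obtain ⟨j, y, hy, hyW⟩ := exists_homogeneous_notMem (K := K)
    (W := Submodule.span K {x} ⊔ W) (by
      intro e
      have h2 := Submodule.finrank_add_le_finrank_add_finrank (Submodule.span K {x}) W
      rw [e, finrank_top] at h2
      have h3 := finrank_span_le_card (R := K) ({x} : Set L)
      rw [Set.toFinset_singleton, Finset.card_singleton] at h3
      omega)
  have hind : ∀ r s : K, r • x + s • y ∈ W → r = 0 ∧ s = 0 := by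
    intro r s h
    have hs : s = 0 := by
      by_contra hs
      refine hyW ((Submodule.smul_mem_iff _ hs).1 (Submodule.mem_sup.2
        ⟨(-r) • x, Submodule.smul_mem _ _ (Submodule.mem_span_singleton_self x), _, h, ?_⟩))
      module
    refine ⟨?_, hs⟩
    by_contra hr
    rw [hs, zero_smul, add_zero] at h
    exact hxW ((Submodule.smul_mem_iff _ hr).1 h)
  refine ⟨i, x, hx, j, y, hy, ?_, hind⟩
  have h2 := finrank_add_two_le (le_sup_right : W ≤ Submodule.span K {x, y} ⊔ W)
    (Submodule.mem_sup_left (Submodule.subset_span (by simp)))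
    (Submodule.mem_sup_left (Submodule.subset_span (by simp))) hind
  exact (Submodule.eq_top_of_finrank_eq
    (le_antisymm (Submodule.finrank_le _) (by omega))).ge

end Generators

/-- The bound on the derived subsuperalgebra of a central extension `E` of `L`. -/
theorem finrank_derived_extension_le {K : Type u} {E : Type w} {L : Type v} [Field K]
    [AddCommGroup E] [Module K E] [LieSuperalgebra K E] [AddCommGroup L] [Module K L]
    [LieSuperalgebra K L] [Module.Finite K L] (h2 : (2 : K) ≠ 0) (h3 : (3 : K) ≠ 0)
    (hnil : Nilpotent K L) {π : Hom K E L} (hπ : Function.Surjective π.toLinearMap)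
    (hc : ∀ a ∈ LinearMap.ker π.toLinearMap, ∀ z, bracket (K := K) (L := E) a z = 0) {m n : ℕ}
    (hm : Module.finrank K (even K L) = m) (hn : Module.finrank K (odd K L) = n)
    (hmn : 6 ≤ m + n) (hn1 : 1 ≤ n) (hder : Module.finrank K (derived K L) + 2 = m + n) :
    Module.Finite K (derived K E) ∧ Module.finrank K (derived K E) + 7 ≤ 2 * m + 3 * n := by
  have hfin : Module.finrank K L = m + n := by
    rw [← hm, ← hn]
    exact (Submodule.finrank_add_eq_of_isCompl (isCompl (K := K) (L := L))).symm
  obtain ⟨i, x, hx, j, y, hy, hgen, hind⟩ := exists_homogeneous_generators (K := K)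
    (W := lowerCentral K L 1) (hder.trans hfin.symm)
  have h : TwoGenerated (⊥ : Submodule K L) x y := by
    refine ⟨?_, ?_, by rwa [sup_bot_eq], hnil⟩
    · intro a ha z
      rw [(Submodule.mem_bot K).1 ha, map_zero, LinearMap.zero_apply]
    · intro a ha z
      rw [(Submodule.mem_bot K).1 ha, map_zero]
  obtain ⟨x, hx', rfl⟩ := Hom.exists_mem_part hπ hx
  obtain ⟨y, hy', rfl⟩ := Hom.exists_mem_part hπ hy
  have h01 : ∀ i : ZMod 2, i = 0 ∨ i = 1 := by decide
  rcases h01 i with rfl | rfl <;> rcases h01 j with rfl | rfl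
  · exfalso
    have e := h.even_eq_top hx hy
    have e' : odd K L = ⊥ := by
      have := (isCompl (K := K) (L := L)).disjoint
      rwa [e, top_disjoint] at this
    rw [e', finrank_bot] at hn
    omega
  · exact finrank_derived_le_of_even_odd h2 h3 hπ hc hx' hy' h hind hn hmn hder
  · refine finrank_derived_le_of_even_odd h2 h3 hπ hc hy' hx' h.symm (fun r s hrs => ?_) hn hmn hder
    exact (hind s r (by rwa [add_comm])).symm
  · exact finrank_derived_le_of_odd_odd h2 h3 hπ hc hx' hy' h hind hn hmn hder

theorem finrank_map_add_finrank_inf_ker {K : Type u} {E : Type w} {L : Type v} [Field K]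
    [AddCommGroup E] [Module K E] [AddCommGroup L] [Module K L] (f : E →ₗ[K] L)
    (V : Submodule K E) [Module.Finite K V] :
    Module.finrank K (V.map f) + Module.finrank K (V ⊓ LinearMap.ker f : Submodule K E) =
      Module.finrank K V := by
  have h := LinearMap.finrank_range_add_finrank_ker (f.domRestrict V)
  rwa [LinearMap.range_domRestrict, LinearMap.ker_domRestrict,
    ← Submodule.finrank_map_subtype_eq V, Submodule.map_comap_subtype] at h

/-! ### From the central extension F/[R, F] to the multiplier. -/

section Multiplier

variable {K : Type u} {L : Type v} [Field K] [AddCommGroup L] [Module K L] [LieSuperalgebra K L]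

theorem FreePresentation.finrank_multiplier (P : FreePresentation.{u, v, w} K L) :
    Module.Finite K
        ((P.R ⊓ derived K (FreeLieSuperalgebra K P.p)).map (commutator P.R ⊤).mkQ) →
      Module.Finite K P.Multiplier ∧ Module.finrank K P.Multiplier = Module.finrank K
        ((P.R ⊓ derived K (FreeLieSuperalgebra K P.p)).map (commutator P.R ⊤).mkQ) := by
  intro hfin
  set V := P.R ⊓ derived K (FreeLieSuperalgebra K P.p) with hV
  set D := commutator P.R ⊤ with hD
  have hker : LinearMap.ker (D.mkQ.domRestrict V) = D.submoduleOf V := by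
    ext z
    rw [LinearMap.mem_ker, LinearMap.domRestrict_apply, Submodule.mkQ_apply,
      Submodule.Quotient.mk_eq_zero]
    rfl
  have hrange : LinearMap.range (D.mkQ.domRestrict V) = V.map D.mkQ :=
    LinearMap.range_domRestrict _ _
  let e : (↥V ⧸ D.submoduleOf V) ≃ₗ[K] V.map D.mkQ :=
    (Submodule.quotEquivOfEq _ _ hker.symm).trans
      ((D.mkQ.domRestrict V).quotKerEquivRange.trans (LinearEquiv.ofEq _ _ hrange))
  exact ⟨Module.Finite.equiv e.symm, e.finrank_eq⟩

theorem FreePresentation.multiplier_bound [Module.Finite K L] (h2 : (2 : K) ≠ 0)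
    (h3 : (3 : K) ≠ 0) (hnil : Nilpotent K L) {m n : ℕ}
    (hm : Module.finrank K (even K L) = m) (hn : Module.finrank K (odd K L) = n)
    (hmn : 6 ≤ m + n) (hn1 : 1 ≤ n) (hder : Module.finrank K (derived K L) + 2 = m + n)
    (P : FreePresentation.{u, v, w} K L) :
    Module.Finite K P.Multiplier ∧ Module.finrank K P.Multiplier + 5 ≤ m + 2 * n := by
  set F := FreeLieSuperalgebra K P.p
  let D : Submodule K F := commutator P.R ⊤
  have hRgr : IsGraded P.R := P.hom.isGraded_ker
  have hDgr : IsGraded D := hRgr.commutator isGraded_top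
  have hDR : D ≤ P.R := P.commutator_le.trans inf_le_left
  have hr : ∀ a ∈ D, ∀ z, bracket (K := K) (L := F) a z ∈ D := fun a ha z =>
    Submodule.apply_mem_map₂ _ (hDR ha) trivial
  -- [R, F] is visibly stable under right brackets; left stability follows by skew-symmetry on
  -- homogeneous components.
  have hl : ∀ z, ∀ a ∈ D, bracket (K := K) (L := F) z a ∈ D := by
    intro z a ha
    obtain ⟨a₀, h₀, a₁, h₁, h₀', h₁', rfl⟩ := hDgr.exists_add_eq ha
    obtain ⟨z₀, hz₀, z₁, hz₁, rfl⟩ := exists_add_eq (K := K) z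
    simp only [map_add, LinearMap.add_apply]
    rw [skew hz₀ h₀', skew hz₀ h₁', skew hz₁ h₀', skew hz₁ h₁']
    have aux : ∀ (c : K) (b : F), b ∈ D → ∀ t, -(c • bracket (K := K) (L := F) b t) ∈ D :=
      fun c b hb t => neg_mem (Submodule.smul_mem _ _ (hr b hb t))
    exact add_mem (add_mem (aux _ _ h₀ _) (aux _ _ h₀ _)) (add_mem (aux _ _ h₁ _) (aux _ _ h₁ _))
  let : LieSuperalgebra K (F ⧸ D) := quotient D hDgr hl hr
  let ρ : Hom K F (F ⧸ D) := quotientProj D hDgr hl hr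
  let π : Hom K (F ⧸ D) L := P.hom.quotientLift D hDgr hl hr hDR
  have hρ : Function.Surjective ρ.toLinearMap := D.mkQ_surjective
  have hπρ : ∀ z, π.toLinearMap (ρ.toLinearMap z) = P.hom.toLinearMap z := fun z => rfl
  have hπ : Function.Surjective π.toLinearMap := by
    intro z
    obtain ⟨t, rfl⟩ := P.surjective z
    exact ⟨_, hπρ t⟩
  have hc : ∀ a ∈ LinearMap.ker π.toLinearMap, ∀ z,
      bracket (K := K) (L := F ⧸ D) a z = 0 := by
    intro a ha z
    obtain ⟨a, rfl⟩ := hρ a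
    obtain ⟨z, rfl⟩ := hρ z
    rw [← ρ.map_bracket]
    exact (Submodule.Quotient.mk_eq_zero _).2 (Submodule.apply_mem_map₂ _ ha trivial)
  obtain ⟨hf, hb⟩ := finrank_derived_extension_le h2 h3 hnil hπ hc hm hn hmn hn1 hder
  have e1 : (derived K F).map ρ.toLinearMap = derived K (F ⧸ D) := Hom.map_lowerCentral hρ 1
  have e2 : (derived K (F ⧸ D)).map π.toLinearMap = derived K L := Hom.map_lowerCentral hπ 1
  have hle : (P.R ⊓ derived K F).map D.mkQ ≤
      derived K (F ⧸ D) ⊓ LinearMap.ker π.toLinearMap := by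
    rintro _ ⟨z, hz, rfl⟩
    exact ⟨e1 ▸ Submodule.mem_map_of_mem (f := ρ.toLinearMap) hz.2, hz.1⟩
  -- Rank-nullity for E² → L²: the kernel, which contains the multiplier, has dimension at most
  -- (2m+3n-7) - (m+n-2) = m+2n-5.
  have hrn := finrank_map_add_finrank_inf_ker π.toLinearMap (derived K (F ⧸ D))
  rw [e2] at hrn
  have : Module.Finite K ↥(derived K (F ⧸ D) ⊓ LinearMap.ker π.toLinearMap) :=
    Submodule.finiteDimensional_of_le inf_le_left
  have hb' := Submodule.finrank_mono hle
  obtain ⟨hM, hMr⟩ := P.finrank_multiplier (Submodule.finiteDimensional_of_le hle)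
  refine ⟨hM, ?_⟩
  change Module.finrank K P.Multiplier = Module.finrank K ((P.R ⊓ derived K F).map D.mkQ) at hMr
  omega

end Multiplier

end LieSuperalgebra

theorem mainTheorem7 {K : Type u} [Field K] (h2 : (2 : K) ≠ 0) (h3 : (3 : K) ≠ 0)
    {L : Type v} [AddCommGroup L] [Module K L] [Module.Finite K L] [LieSuperalgebra K L]
    (hnil : LieSuperalgebra.Nilpotent K L) (m n : ℕ)
    (hm : Module.finrank K (LieSuperalgebra.even K L) = m)
    (hn : Module.finrank K (LieSuperalgebra.odd K L) = n)
    (hmn : 6 ≤ m + n) (hn1 : 1 ≤ n)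
    (hder : (Module.finrank K (LieSuperalgebra.derived K L) : ℤ) = (m : ℤ) + n - 2)
    (P : LieSuperalgebra.FreePresentation.{u, v, w} K L) :
    Module.Finite K P.Multiplier ∧
      (Module.finrank K P.Multiplier : ℤ) ≤ (m : ℤ) + 2 * n - 5 := by
  obtain ⟨hf, hb⟩ := P.multiplier_bound h2 h3 hnil hm hn hmn hn1 (by omega)
  exact ⟨hf, by omega⟩
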